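/- Let $\mathfrak g$ be a finite-dimensional complex semisimple Lie algebra with Cartan subalgebra $\mathfrak h$, set of roots $\Pi$ and Cartan--Killing form $\langle\cdot,\cdot\rangle$, and let $\mathfrak h_{\mathbb R}\subset\mathfrak h$ be the real subspace generated by the roots (regarded as elements of $\mathfrak h$ via $\langle\cdot,\cdot\rangle$). Let $H_0\in\mathfrak h$ and let $H\in\mathfrak h_{\mathbb R}$ be regular, i.e. $\alpha(H)\neq 0$ for all $\alpha\in\Pi$. Let $\mathcal O(H_0)\subset\mathfrak g$ be the adjoint orbit of $H_0$, that is, its orbit under the group generated by all $e^{\mathrm{ad}X}$, $X\in\mathfrak g$; it is an embedded complex submanifold of $\mathfrak g$, of even complex dimension $2n$. Let $f_H:\mathcal O(H_0)\to\mathbb C$, $f_H(x)=\langle H,x\rangle$. Then $f_H$ has finitely many critical points and defines a Lefschetz fibration in the following sense: 1. every critical point of $f_H$ has nondegenerate (complex) Hessian; 2. if $c_1,c_2\in\mathbb C$ are regular values, then $f_H^{-1}(c_1)$ and $f_H^{-1}(c_2)$ are diffeomorphic; and there is a symplectic form $\Omega$ on $\mathcal O(H_0)$ (a smooth, closed, nondegenerate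 real $2$-form) such that 3. for every regular value $c$, the fibre $f_H^{-1}(c)$ is a symplectic submanifold of $(\mathcal O(H_0),\Omega)$; 4. for every critical value $c$, the fibre $f_H^{-1}(c)$ is a disjoint union of complex affine subspaces of $\mathfrak g$ contained in $\mathcal O(H_0)$, each of complex dimension $n$ or $n-1$ and each symplectic with respect to $\Omega$. (A regular value is a complex number whose fibre contains no critical point.) -/

import Mathlib

open Set
open scoped ContDiff Topology

/-! ### Lie algebras on an underlying normed space

A finite-dimensional complex Lie algebra carries a unique vector-space topology, induced by any norm.
The two classes below attach a norm to a Lie algebra in order to speak of smoothness.  No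
compatibility between the norm and the bracket is required, so every norm is allowed. -/

/-- A Lie ring with a norm on its underlying additive group (arbitrary, unrelated to the bracket). -/
class NormedLieRing (L : Type*) extends NormedAddCommGroup L, LieRing L

/-- A Lie algebra over `𝕜` whose underlying vector space is a normed space. -/
class NormedLieAlgebra (𝕜 L : Type*) [NormedField 𝕜] [NormedLieRing L] extends
  NormedSpace 𝕜 L, LieAlgebra 𝕜 L

noncomputable section

/-! ### Embedded submanifolds of a normed space -/

section Submanifolds

variable {E : Type*} [NormedAddCommGroup E]

/-- `φ` is a slice chart at `x ∈ M`: a smooth (over `ℂ`: holomorphic) diffeomorphism from an open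
neighbourhood of `x` onto an open set, under which `M` corresponds to the linear subspace `V`. -/
structure IsSliceChart (𝕜 : Type*) [RCLike 𝕜] [NormedSpace 𝕜 E] (M : Set E) (x : E)
    (V : Submodule 𝕜 E) (φ : OpenPartialHomeomorph E E) : Prop where
  mem : x ∈ M
  mem_source : x ∈ φ.source
  contDiffOn : ContDiffOn 𝕜 ∞ φ φ.source
  contDiffOn_symm : ContDiffOn 𝕜 ∞ φ.symm φ.target
  isImage : φ.IsImage M (V : Set E)

/-- `M` is an embedded submanifold of `E` of dimension `d` over `𝕜` (smooth for `𝕜 = ℝ`, complex for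
`𝕜 = ℂ`): it admits a slice chart at each of its points. -/
def IsSubmanifold (𝕜 : Type*) [RCLike 𝕜] [NormedSpace 𝕜 E] (d : ℕ) (M : Set E) : Prop :=
  ∀ x ∈ M, ∃ (V : Submodule 𝕜 E) (φ : OpenPartialHomeomorph E E),
    Module.finrank 𝕜 V = d ∧ IsSliceChart 𝕜 M x V φ

/-- The (real) tangent space of `M` at `x`, as a subspace of the ambient space. -/
def tangentSpaceAt [NormedSpace ℝ E] (M : Set E) (x : E) : Submodule ℝ E :=
  Submodule.span ℝ (tangentConeAt ℝ M x)

/-- `a : M → E` is smooth: locally it is the restriction of a smooth map on an open set of `E`. -/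
def SmoothOnSubmanifold [NormedSpace ℝ E] {F : Type*} [NormedAddCommGroup F] [NormedSpace ℝ F]
    (a : E → F) (M : Set E) : Prop :=
  ∀ x ∈ M, ∃ (U : Set E) (A : E → F), IsOpen U ∧ x ∈ U ∧ ContDiffOn ℝ ∞ A U ∧ EqOn a A (U ∩ M)

/-- The submanifolds `M` and `N` are diffeomorphic: there are mutually inverse smooth maps
`a : M → N` and `b : N → M`. -/
def AreDiffeomorphic [NormedSpace ℝ E] (M N : Set E) : Prop :=
  ∃ a b : E → E, MapsTo a M N ∧ MapsTo b N M ∧ InvOn b a M N ∧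
    SmoothOnSubmanifold a M ∧ SmoothOnSubmanifold b N

/-! ### Critical points of a function on a submanifold

Here `f : E → ℂ` is a function on the ambient space, and one studies its restriction to `M`. -/

/-- The set of critical points of `f|_M`: the points where its differential vanishes. -/
def criticalPoints [NormedSpace ℝ E] (M : Set E) (f : E → ℂ) : Set E :=
  {x | x ∈ M ∧ ∀ v ∈ tangentSpaceAt M x, fderiv ℝ f x v = 0}

/-- The fibre of `f|_M` over `c`. -/
def fibre (M : Set E) (f : E → ℂ) (c : ℂ) : Set E :=
  {x | x ∈ M ∧ f x = c}

/-- `c` is a critical value of `f|_M`. -/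
def IsCriticalValue [NormedSpace ℝ E] (M : Set E) (f : E → ℂ) (c : ℂ) : Prop :=
  ∃ x ∈ criticalPoints M f, f x = c

/-- `c` is a regular value of `f|_M`: the fibre over `c` contains no critical point. -/
def IsRegularValue [NormedSpace ℝ E] (M : Set E) (f : E → ℂ) (c : ℂ) : Prop :=
  ¬ IsCriticalValue M f c

/-- The complex Hessian of `f|_M` at the critical point `x` is nondegenerate: in a holomorphic chart
of `M` at `x` (obtained by restricting a slice chart), the matrix of second derivatives is
nondegenerate.  At a critical point this does not depend on the chart. -/
def HessianNondegenerate [NormedSpace ℂ E] (M : Set E) (f : E → ℂ) (x : E) : Prop :=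
  ∃ (V : Submodule ℂ E) (φ : OpenPartialHomeomorph E E), IsSliceChart ℂ M x V φ ∧
    ∀ v : V, (∀ w : V,
      fderiv ℂ (fderiv ℂ (fun u : V => f (φ.symm (φ x + (u : E))))) 0 v w = 0) → v = 0

/-! ### Symplectic forms and symplectic submanifolds

A `2`-form on the submanifold `M` is given by alternating bilinear forms `Ω x`, `x ∈ M`, of which
only the restriction to the tangent space of `M` at `x` is used. -/

/-- `Ω` restricts to a nondegenerate form on the tangent space of `N` at `x`. -/
def NondegenerateOnTangent [NormedSpace ℝ E] (Ω : E → E [⋀^Fin 2]→L[ℝ] ℝ) (N : Set E) (x : E) :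
    Prop :=
  ∀ v ∈ tangentSpaceAt N x, (∀ w ∈ tangentSpaceAt N x, Ω x ![v, w] = 0) → v = 0

/-- `Ω` is a symplectic form on `M`: it is nondegenerate and, near each point of `M`, it is the
pullback to `M` of a smooth `2`-form `η` on an open subset of the ambient space with `dη` pulling
back to zero on `M`. -/
def IsSymplecticForm [NormedSpace ℝ E] (M : Set E) (Ω : E → E [⋀^Fin 2]→L[ℝ] ℝ) : Prop :=
  (∀ x ∈ M, NondegenerateOnTangent Ω M x) ∧
  ∀ x ∈ M, ∃ (U : Set E) (η : E → E [⋀^Fin 2]→L[ℝ] ℝ),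
    IsOpen U ∧ x ∈ U ∧ ContDiffOn ℝ ∞ η U ∧
    (∀ y ∈ U ∩ M, ∀ v ∈ tangentSpaceAt M y, ∀ w ∈ tangentSpaceAt M y,
      Ω y ![v, w] = η y ![v, w]) ∧
    (∀ y ∈ U ∩ M, ∀ u ∈ tangentSpaceAt M y, ∀ v ∈ tangentSpaceAt M y, ∀ w ∈ tangentSpaceAt M y,
      extDeriv η y ![u, v, w] = 0)

/-- `N` is a symplectic submanifold of `(M, Ω)`. -/
def IsSymplecticSubmanifold [NormedSpace ℝ E] (M : Set E) (Ω : E → E [⋀^Fin 2]→L[ℝ] ℝ)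
    (N : Set E) : Prop :=
  N ⊆ M ∧ (∃ d : ℕ, IsSubmanifold ℝ d N) ∧ ∀ x ∈ N, NondegenerateOnTangent Ω N x

end Submanifolds

/-! ### Adjoint orbits and height functions -/

section LieAlgebras

variable (𝔤 : Type*) [NormedLieRing 𝔤] [NormedLieAlgebra ℂ 𝔤] [FiniteDimensional ℂ 𝔤]

/-- The adjoint group of `𝔤`, that is the image under `Ad` of any connected Lie group with Lie
algebra `𝔤`: the group of linear automorphisms generated by the `exp (ad X)`, `X ∈ 𝔤`. -/
def adjointGroup : Subgroup (𝔤 →L[ℂ] 𝔤)ˣ :=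
  Subgroup.closure {u | ∃ X : 𝔤,
    (u : 𝔤 →L[ℂ] 𝔤) = NormedSpace.exp (LinearMap.toContinuousLinearMap (LieAlgebra.ad ℂ 𝔤 X))}

variable {𝔤}

/-- The adjoint orbit `𝒪(H₀)`. -/
def adjointOrbit (H₀ : 𝔤) : Set 𝔤 :=
  {x | ∃ u ∈ adjointGroup 𝔤, x = (u : 𝔤 →L[ℂ] 𝔤) H₀}

/-- The height function `f_H(x) = ⟨H, x⟩`, with `⟨·, ·⟩` the Cartan-Killing form. -/
def heightFunction (H : 𝔤) (x : 𝔤) : ℂ :=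
  killingForm ℂ 𝔤 H x

variable [LieAlgebra.IsSemisimple ℂ 𝔤] (𝔥 : LieSubalgebra ℂ 𝔤) [𝔥.IsCartanSubalgebra]

/-- The real subspace `𝔥_ℝ` of `𝔥` generated by the roots, each root being regarded as an element of
`𝔥` through the Killing form. -/
def realCartan : Submodule ℝ 𝔥 :=
  Submodule.span ℝ
    {h | ∃ α ∈ 𝔥.root, h = (LieAlgebra.IsKilling.cartanEquivDual 𝔥).symm α.toLinear}

variable {𝔥}

/-- `H ∈ 𝔥` is regular: no root vanishes at `H`. -/
def IsRegularElement (H : 𝔥) : Prop :=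
  ∀ α ∈ 𝔥.root, α H ≠ 0

end LieAlgebras

end

/-! Since `H₀` lies in a Cartan subalgebra, `ad H₀` is annihilated by a squarefree polynomial `p`,
and `p (ad x) = 0` is a closed condition stable under the adjoint group (`adVariety`). Two nearby
commuting solutions coincide: their difference is ad-semisimple, and its eigenvalues are small
differences of roots of `p`, hence zero. Together with the slice `u ↦ exp (ad (τ u)) (x + u - π u)`
this makes the orbit closed and embedded, with tangent space `range (ad x)` at `x`
(`exists_straightening`).

By invariance of the Killing form, `x` is critical iff `[H, x] = 0`. Regularity of `H` then puts `x`
in `𝔥`, where its weights are roots of `p`, so critical points are finite in number. In the slice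
chart the Hessian is `(v, w) ↦ ⟨[H, τ v], w⟩`. A vector in its radical lies in `𝔥` and in `range (ad
x)`; commuting with `x`, it is zero.

The symplectic form is the imaginary part of a constant Hermitian product. It is closed, and
nondegenerate on every complex subspace, which settles all the symplectic claims.

For the affine pieces, choose a real functional `l` on `ℂ` nonzero at the nonzero roots of `p`, and
let `N` be the sum of the eigenspaces of `ad H₀` on which `l` is positive. The Killing form pairs
`N` with its opposite, so `N` has half the dimension of the orbit. Unipotent elements act
transitively on `H₀ + N`, and the translates of this leaf partition the orbit. The height is affine
on each, so a fibre meets a leaf in nothing, in everything or in a hyperplane.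

Comparing regular fibres needs control at infinity. The moves `x ↦ exp (s ad Y(x)) x`, with `Y(x) =
σ[H, x] / (1 + ‖x‖²)`, change the height at rate `-‖[H, x]‖² / (1 + ‖x‖²)`. Rescaled limits of orbit
points going to infinity are ad-nilpotent, and none commutes with `H`, since such a limit would lie
in `𝔥` and vanish. So the rate is bounded away from zero near a regular value
(`exists_le_norm_lie_div`). A uniform implicit function theorem (`exists_small_solution`) then
matches nearby fibres without integrating a flow, and the complement of the finitely many critical
values is connected. -/

set_option linter.unusedSectionVars false

noncomputable section

/-! ### Slice charts and tangent spaces from straightening maps -/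

section SliceCharts

open Filter

variable {E : Type*} [NormedAddCommGroup E]

/-- A local analytic diffeomorphism `G` straightening `M` near `x` to a subspace gives a slice
chart. -/
theorem exists_isSliceChart {𝕜 : Type*} [RCLike 𝕜] [NormedSpace 𝕜 E] [CompleteSpace E]
    {M : Set E} {x : E} {V : Submodule 𝕜 E} {G : E → E} (hG : ContDiffAt 𝕜 ω G x)
    (hD : HasFDerivAt G (ContinuousLinearMap.id 𝕜 E) x) (hx : x ∈ M)
    (h : ∀ᶠ y in 𝓝 x, y ∈ M ↔ G y ∈ V) :
    ∃ φ : OpenPartialHomeomorph E E, IsSliceChart 𝕜 M x V φ ∧ ⇑φ = G := by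
  have hD' : HasFDerivAt G ((ContinuousLinearEquiv.refl 𝕜 E : E ≃L[𝕜] E) : E →L[𝕜] E) x := hD
  have hω : (ω : WithTop ℕ∞) ≠ 0 := by simp
  set Φ := hG.toOpenPartialHomeomorph G hD' hω with hΦ
  have hΦG : ⇑Φ = G := rfl
  have hxs : x ∈ Φ.source := hG.mem_toOpenPartialHomeomorph_source hD' hω
  have hsymm : ContDiffAt 𝕜 ω Φ.symm (Φ x) := by
    refine Φ.contDiffAt_symm (Φ.map_source hxs) (f₀' := ContinuousLinearEquiv.refl 𝕜 E) ?_ ?_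
    · rw [Φ.left_inv hxs]; exact hD'
    · rw [Φ.left_inv hxs]; exact hG
  -- Order `ω` at a point persists on a neighbourhood, which order `∞` at a point need not do.
  have h1 : ∀ᶠ y in 𝓝 x, ContDiffAt 𝕜 ω G y := hG.eventually (by simp)
  have h2 : ∀ᶠ y in 𝓝 x, ContDiffAt 𝕜 ω Φ.symm (Φ y) :=
    (Φ.continuousAt hxs).eventually (hsymm.eventually (by simp))
  obtain ⟨s, hs, hso, hxs'⟩ := eventually_nhds_iff.1 (h1.and (h2.and h))
  refine ⟨Φ.restrOpen s hso, ⟨hx, ?_, ?_, ?_, ?_⟩, rfl⟩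
  · rw [Φ.restrOpen_source]; exact ⟨hxs, hxs'⟩
  · intro y hy
    rw [Φ.restrOpen_source] at hy
    exact ((hs y hy.2).1.of_le le_top).contDiffWithinAt
  · intro y hy
    have hy1 := (Φ.restrOpen s hso).map_target hy
    have hy2 := (Φ.restrOpen s hso).right_inv hy
    rw [Φ.restrOpen_source] at hy1
    have := (hs _ hy1.2).2.1
    change ContDiffAt 𝕜 ω Φ.symm ((Φ.restrOpen s hso) ((Φ.restrOpen s hso).symm y)) at this
    rw [hy2] at this
    exact (this.of_le le_top).contDiffWithinAt
  · intro y hy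
    rw [Φ.restrOpen_source] at hy
    exact (hs y hy.2).2.2.symm

theorem tangentConeAt_submodule [NormedSpace ℝ E] [FiniteDimensional ℝ E] (V : Submodule ℝ E)
    {x : E} (hx : x ∈ V) : tangentConeAt ℝ (V : Set E) x = V := by
  apply Subset.antisymm
  · intro y hy
    obtain ⟨ι, l, hl, c, d, -, hd, hcd⟩ := exists_fun_of_mem_tangentConeAt hy
    refine V.closed_of_finiteDimensional.mem_of_tendsto hcd (hd.mono fun n hn => ?_)
    exact V.smul_mem _ (by simpa using V.sub_mem hn hx)
  · intro y hy
    have := mem_tangentConeAt_of_segment_subset (s := (V : Set E)) (x := x) (y := x + y)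
      (V.convex.segment_subset hx (V.add_mem hx hy))
    simpa using this

/-- The tangent space of a set which is straightened to `V` by a map with derivative `1` is `V`. -/
theorem tangentSpaceAt_eq [NormedSpace ℝ E] [FiniteDimensional ℝ E]
    {M : Set E} {x : E} {V : Submodule ℝ E} {G : E → E}
    (hD : HasStrictFDerivAt G (ContinuousLinearMap.id ℝ E) x) (hx : x ∈ M)
    (h : ∀ᶠ y in 𝓝 x, y ∈ M ↔ G y ∈ V) : tangentSpaceAt M x = V := by
  have : CompleteSpace E := FiniteDimensional.complete ℝ E
  have hD' : HasStrictFDerivAt G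
    ((ContinuousLinearEquiv.refl ℝ E : E ≃L[ℝ] E) : E →L[ℝ] E) x := hD
  have hGx : G x ∈ V := (h.self_of_nhds).1 hx
  suffices hc : tangentConeAt ℝ M x = V by rw [tangentSpaceAt, hc, Submodule.span_eq]
  rw [← tangentConeAt_submodule V hGx]
  obtain ⟨U, hU, hUo, hxU⟩ := eventually_nhds_iff.1 h
  apply Subset.antisymm
  · intro v hv
    rw [← tangentConeAt_inter_nhds (hUo.mem_nhds hxU)] at hv
    have := hD.hasFDerivAt.hasFDerivWithinAt.mapsTo_tangent_cone hv
    refine tangentConeAt_mono ?_ this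
    rintro _ ⟨y, hy, rfl⟩
    exact (hU y hy.2).1 hy.1
  · intro v hv
    -- The reverse inclusion transports the tangent cone of `V` by the local inverse of `G`.
    set K := hD'.localInverse G _ x with hK
    have hKD : HasStrictFDerivAt K (ContinuousLinearMap.id ℝ E) (G x) := hD'.to_localInverse
    have hKx : K (G x) = x := hD'.localInverse_apply_image
    have hr : ∀ᶠ z in 𝓝 (G x), G (K z) = z := hD'.eventually_right_inverse
    have hKU : ∀ᶠ z in 𝓝 (G x), K z ∈ U := by
      have := hKD.continuousAt
      rw [ContinuousAt, hKx] at this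
      exact this.eventually (hUo.mem_nhds hxU)
    rw [← tangentConeAt_inter_nhds (hr.and hKU)] at hv
    have := hKD.hasFDerivAt.hasFDerivWithinAt.mapsTo_tangent_cone hv
    rw [hKx] at this
    refine tangentConeAt_mono ?_ this
    rintro _ ⟨z, ⟨hz, hz1, hz2⟩, rfl⟩
    exact (hU _ hz2).2 (by rw [hz1]; exact hz)

/-- Affine subspaces are submanifolds. -/
theorem AffineSubspace.isSubmanifold_real [NormedSpace ℂ E] [FiniteDimensional ℂ E]
    (A : AffineSubspace ℂ E) : ∃ d, IsSubmanifold ℝ d (A : Set E) := by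
  have : CompleteSpace E := FiniteDimensional.complete ℂ E
  refine ⟨Module.finrank ℝ (A.direction.restrictScalars ℝ), fun x hx => ?_⟩
  obtain ⟨φ, hφ, -⟩ := exists_isSliceChart (𝕜 := ℝ) (M := (A : Set E)) (x := x)
    (V := A.direction.restrictScalars ℝ) (G := fun y => y - x) (by fun_prop)
    ((hasFDerivAt_id x).sub_const x) hx (.of_forall fun y => by
      simpa using (AffineSubspace.vsub_right_mem_direction_iff_mem hx y).symm)
  exact ⟨_, φ, rfl, hφ⟩

theorem AffineSubspace.tangentSpaceAt_eq [NormedSpace ℂ E] [FiniteDimensional ℂ E]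
    (A : AffineSubspace ℂ E) {x : E} (hx : x ∈ A) :
    tangentSpaceAt (A : Set E) x = A.direction.restrictScalars ℝ := by
  have : FiniteDimensional ℝ E := FiniteDimensional.complexToReal E
  refine _root_.tangentSpaceAt_eq (G := fun y => y - x)
    ((hasStrictFDerivAt_id x).sub_const x) hx (.of_forall fun y => ?_)
  simpa using (AffineSubspace.vsub_right_mem_direction_iff_mem hx y).symm

end SliceCharts

/-! ### Smooth maps between embedded submanifolds -/

section Diffeomorphisms

variable {E : Type*} [NormedAddCommGroup E] [NormedSpace ℝ E]

theorem SmoothOnSubmanifold.comp {a b : E → E} {M N : Set E} (hb : SmoothOnSubmanifold b N)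
    (ha : SmoothOnSubmanifold a M) (h : MapsTo a M N) : SmoothOnSubmanifold (b ∘ a) M := by
  intro x hx
  obtain ⟨U, A, hU, hxU, hA, hAa⟩ := ha x hx
  obtain ⟨W, B, hW, hxW, hB, hBb⟩ := hb (a x) (h hx)
  refine ⟨U ∩ A ⁻¹' W, B ∘ A, hA.continuousOn.isOpen_inter_preimage hU hW, ⟨hxU, ?_⟩, ?_, ?_⟩
  · rw [mem_preimage, ← hAa ⟨hxU, hx⟩]; exact hxW
  · exact hB.comp (hA.mono inter_subset_left) fun y hy => hy.2
  · rintro y ⟨⟨hy1, hy2⟩, hy3⟩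
    have h1 := hAa ⟨hy1, hy3⟩
    rw [Function.comp_apply, Function.comp_apply, ← h1]
    exact hBb ⟨by rw [h1]; exact hy2, h hy3⟩

theorem AreDiffeomorphic.symm {M N : Set E} (h : AreDiffeomorphic M N) : AreDiffeomorphic N M := by
  obtain ⟨a, b, ha, hb, hi, sa, sb⟩ := h
  exact ⟨b, a, hb, ha, hi.symm, sb, sa⟩

theorem AreDiffeomorphic.trans {M N K : Set E} (h : AreDiffeomorphic M N)
    (h' : AreDiffeomorphic N K) : AreDiffeomorphic M K := by
  obtain ⟨a, b, ha, hb, hi, sa, sb⟩ := h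
  obtain ⟨a', b', ha', hb', hi', sa', sb'⟩ := h'
  refine ⟨a' ∘ a, b ∘ b', ha'.comp ha, hb.comp hb', ⟨fun x hx => ?_, fun x hx => ?_⟩,
    sa'.comp sa ha, sb.comp sb' hb'⟩
  · simp only [Function.comp_apply]
    rw [hi'.1 (ha hx), hi.1 hx]
  · simp only [Function.comp_apply]
    rw [hi.2 (hb' hx), hi'.2 hx]

/-- A function determined on `A` as the unique solution, in a given open set, of an analytic
equation with invertible partial derivative is smooth along `A`. -/
theorem exists_contDiffAt_of_unique_solution
    {X S Z : Type*} [NormedAddCommGroup X] [NormedSpace ℝ X] [CompleteSpace X]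
    [NormedAddCommGroup S] [NormedSpace ℝ S] [CompleteSpace S]
    [NormedAddCommGroup Z] [NormedSpace ℝ Z] [CompleteSpace Z]
    {F : X × S → Z} {x₀ : X} {u : X → S} {A : Set X} {B : Set S}
    (hF : ContDiffAt ℝ ω F (x₀, u x₀))
    (hinv : (fderiv ℝ F (x₀, u x₀) ∘L .inr ℝ X S).IsInvertible) (hB : IsOpen B) (huB : u x₀ ∈ B)
    (huniq : ∀ x ∈ A, ∀ s ∈ B, F (x, s) = F (x₀, u x₀) → s = u x) :
    ∃ σ : X → S, ContDiffAt ℝ ω σ x₀ ∧ ∀ᶠ x in 𝓝 x₀, x ∈ A → u x = σ x := by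
  have hω : (ω : WithTop ℕ∞) ≠ 0 := by simp
  have hc := hF.contDiffAt_implicitFunction hω hinv
  refine ⟨_, hc, ?_⟩
  have hs := hF.implicitFunction_apply_self hω hinv
  -- The implicit function stays in the open set `B`, so uniqueness forces it to agree with `u` on
  -- `A`. Continuity of `u` is not needed.
  have hmem : ∀ᶠ x in 𝓝 x₀, hF.implicitFunction hω hinv x ∈ B := by
    refine hc.continuousAt.eventually (hB.mem_nhds ?_)
    simpa [hs] using huB
  filter_upwards [hmem, hF.eventually_apply_implicitFunction hω hinv] with x h1 h2 hx
  exact (huniq x hx _ h1 h2).symm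

theorem smoothOnSubmanifold_of_contDiffAt {F : Type*} [NormedAddCommGroup F] [NormedSpace ℝ F]
    {a : E → F} {M : Set E}
    (h : ∀ x ∈ M, ∃ A : E → F, ContDiffAt ℝ ω A x ∧ ∀ᶠ y in 𝓝 x, y ∈ M → a y = A y) :
    SmoothOnSubmanifold a M := by
  intro x hx
  obtain ⟨A, hA, hAa⟩ := h x hx
  obtain ⟨U, hU, hUo, hxU⟩ := eventually_nhds_iff.1 ((hA.eventually (by simp)).and hAa)
  exact ⟨U, A, hUo, hxU, fun y hy => ((hU y hy).1.of_le le_top).contDiffWithinAt,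
    fun y hy => (hU y hy.1).2 hy.2⟩

end Diffeomorphisms

/-! ### The adjoint group acts by Lie algebra automorphisms -/

section AdjointGroup

variable {𝔤 : Type*} [NormedLieRing 𝔤] [NormedLieAlgebra ℂ 𝔤] [FiniteDimensional ℂ 𝔤]

/-- The adjoint representation, with values in the continuous linear maps. -/
def adL : 𝔤 →L[ℂ] 𝔤 →L[ℂ] 𝔤 :=
  LinearMap.toContinuousLinearMap
    ((LinearMap.toContinuousLinearMap : (𝔤 →ₗ[ℂ] 𝔤) ≃ₗ[ℂ] (𝔤 →L[ℂ] 𝔤)).toLinearMap ∘ₗ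
      (LieAlgebra.ad ℂ 𝔤 : 𝔤 →ₗ[ℂ] Module.End ℂ 𝔤))

@[simp] theorem adL_apply (x y : 𝔤) : adL x y = ⁅x, y⁆ := rfl

instance instCompleteSpaceNormedLie : CompleteSpace 𝔤 := FiniteDimensional.complete ℂ 𝔤

/-- `exp (ad X)` as an element of the adjoint group. -/
theorem exists_mem_adjointGroup (X : 𝔤) :
    ∃ u ∈ adjointGroup 𝔤, (u : 𝔤 →L[ℂ] 𝔤) = NormedSpace.exp (adL X) := by
  obtain ⟨u, hu⟩ : IsUnit (NormedSpace.exp (adL X)) := by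
    let +nondep : NormedAlgebra ℚ (𝔤 →L[ℂ] 𝔤) := .restrictScalars ℚ ℂ (𝔤 →L[ℂ] 𝔤)
    exact NormedSpace.isUnit_exp _
  exact ⟨u, Subgroup.subset_closure ⟨X, hu⟩, hu⟩

/-- As `D = ad X` is a derivation, `exp (-tD) [exp (tD) a, exp (tD) b]` has zero derivative in `t`;
compare `t = 1` with `t = 0`. -/
theorem exp_adL_lie (X a b : 𝔤) :
    NormedSpace.exp (adL X) ⁅a, b⁆ = ⁅NormedSpace.exp (adL X) a, NormedSpace.exp (adL X) b⁆ := by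
  set D := adL X with hD
  let e : ℂ → (𝔤 →L[ℂ] 𝔤) := fun t => NormedSpace.exp (t • D)
  let φ : ℂ → 𝔤 := fun t => e (-t) (adL (e t a) (e t b))
  have he : ∀ t, HasDerivAt e (D * e t) t := fun t => hasDerivAt_exp_smul_const' D t
  have he' : ∀ t, HasDerivAt (fun t => e (-t)) (-(e (-t) * D)) t := fun t => by
    have := (hasDerivAt_exp_smul_const D (-t)).scomp t (hasDerivAt_neg t)
    refine this.congr_deriv ?_
    simp [e]
  have hφ : ∀ t, HasDerivAt φ 0 t := fun t => by
    have ha := (he t).clm_apply (hasDerivAt_const t a)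
    have hb := (he t).clm_apply (hasDerivAt_const t b)
    have hab := (((adL (𝔤 := 𝔤)).hasFDerivAt.comp_hasDerivAt t ha).clm_apply hb)
    have := (he' t).clm_apply hab
    refine this.congr_deriv ?_
    simp [hD]
  have hc : φ 1 = φ 0 :=
    is_const_of_deriv_eq_zero (fun t => (hφ t).differentiableAt) (fun t => (hφ t).deriv) 1 0
  have h0 : φ 0 = ⁅a, b⁆ := by simp [φ, e]
  have h1 : φ 1 = NormedSpace.exp (-D) ⁅NormedSpace.exp D a, NormedSpace.exp D b⁆ := by
    simp [φ, e]
  have hinv : NormedSpace.exp D * NormedSpace.exp (-D) = 1 := by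
    let +nondep : NormedAlgebra ℚ (𝔤 →L[ℂ] 𝔤) := .restrictScalars ℚ ℂ (𝔤 →L[ℂ] 𝔤)
    rw [← NormedSpace.exp_add_of_commute (Commute.refl D).neg_right]; simp
  rw [← h0, ← hc, h1, ← mul_apply_eq_comp, hinv, one_apply_eq_self]

theorem units_apply_inv_apply (u : (𝔤 →L[ℂ] 𝔤)ˣ) (c : 𝔤) :
    (u : 𝔤 →L[ℂ] 𝔤) ((↑u⁻¹ : 𝔤 →L[ℂ] 𝔤) c) = c := by
  rw [← mul_apply_eq_comp, Units.mul_inv, one_apply_eq_self]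

theorem units_inv_apply_apply (u : (𝔤 →L[ℂ] 𝔤)ˣ) (c : 𝔤) :
    (↑u⁻¹ : 𝔤 →L[ℂ] 𝔤) ((u : 𝔤 →L[ℂ] 𝔤) c) = c := by
  rw [← mul_apply_eq_comp, Units.inv_mul, one_apply_eq_self]

theorem adjointGroup_lie {u : (𝔤 →L[ℂ] 𝔤)ˣ} (hu : u ∈ adjointGroup 𝔤) (a b : 𝔤) :
    (u : 𝔤 →L[ℂ] 𝔤) ⁅a, b⁆ = ⁅(u : 𝔤 →L[ℂ] 𝔤) a, (u : 𝔤 →L[ℂ] 𝔤) b⁆ := by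
  induction hu using Subgroup.closure_induction generalizing a b with
  | mem u hu =>
    obtain ⟨X, hX⟩ := hu
    rw [hX]
    exact exp_adL_lie X a b
  | one => simp
  | mul u v _ _ hu hv => simp [hu, hv]
  | inv u _ hu =>
    rw [← units_inv_apply_apply u ⁅(↑u⁻¹ : 𝔤 →L[ℂ] 𝔤) a, (↑u⁻¹ : 𝔤 →L[ℂ] 𝔤) b⁆, hu,
      units_apply_inv_apply, units_apply_inv_apply]

theorem apply_mem_adjointOrbit_iff {u : (𝔤 →L[ℂ] 𝔤)ˣ} (hu : u ∈ adjointGroup 𝔤) {x y : 𝔤} :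
    (u : 𝔤 →L[ℂ] 𝔤) y ∈ adjointOrbit x ↔ y ∈ adjointOrbit x := by
  constructor
  · rintro ⟨v, hv, h⟩
    refine ⟨u⁻¹ * v, mul_mem (inv_mem hu) hv, ?_⟩
    rw [Units.val_mul, mul_apply_eq_comp, ← h, units_inv_apply_apply]
  · rintro ⟨v, hv, rfl⟩
    exact ⟨u * v, mul_mem hu hv, rfl⟩

theorem exp_adL_apply_mem_adjointOrbit_iff {X x y : 𝔤} :
    NormedSpace.exp (adL X) y ∈ adjointOrbit x ↔ y ∈ adjointOrbit x := by
  obtain ⟨u, hu, h⟩ := exists_mem_adjointGroup X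
  rw [← h]
  exact apply_mem_adjointOrbit_iff hu

end AdjointGroup

/-! ### The closed invariant set `p (ad x) = 0` -/

section AdVariety

open Polynomial Filter

variable {𝔤 : Type*} [NormedLieRing 𝔤] [NormedLieAlgebra ℂ 𝔤] [FiniteDimensional ℂ 𝔤]

/-- The elements `x` such that `p` annihilates `ad x`. -/
def adVariety (p : ℂ[X]) : Set 𝔤 := {x | aeval (adL x) p = 0}

theorem isClosed_adVariety (p : ℂ[X]) : IsClosed (adVariety p : Set 𝔤) :=
  isClosed_eq (p.continuous_aeval.comp adL.continuous) continuous_const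

theorem aeval_adL_apply (x y : 𝔤) (p : ℂ[X]) :
    aeval (adL x) p y = aeval (LieAlgebra.ad ℂ 𝔤 x) p y := by
  induction p using Polynomial.induction_on generalizing y with
  | C a => simp
  | add p q hp hq => simp [hp, hq]
  | monomial n a h =>
    rw [pow_succ, ← mul_assoc, map_mul (aeval (adL x)), map_mul (aeval (LieAlgebra.ad ℂ 𝔤 x)),
      aeval_X, aeval_X]
    exact h _

theorem mem_adVariety_iff {p : ℂ[X]} {x : 𝔤} :
    x ∈ adVariety p ↔ aeval (LieAlgebra.ad ℂ 𝔤 x) p = 0 := by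
  rw [adVariety, mem_ofPred_eq]
  constructor
  · intro h; ext y; rw [← aeval_adL_apply, h]; rfl
  · intro h; ext y; rw [aeval_adL_apply, h]; rfl

/-- The operators `ad (u x)` and `ad x` are conjugate by `u`, so the same polynomials annihilate
them. -/
theorem apply_mem_adVariety {u : (𝔤 →L[ℂ] 𝔤)ˣ} (hu : u ∈ adjointGroup 𝔤) {x : 𝔤} {p : ℂ[X]}
    (hx : x ∈ adVariety p) : (u : 𝔤 →L[ℂ] 𝔤) x ∈ adVariety p := by
  have h : ∀ (q : ℂ[X]) (y : 𝔤), aeval (adL ((u : 𝔤 →L[ℂ] 𝔤) x)) q ((u : 𝔤 →L[ℂ] 𝔤) y) =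
      (u : 𝔤 →L[ℂ] 𝔤) (aeval (adL x) q y) := by
    intro q
    induction q using Polynomial.induction_on with
    | C a => simp
    | add p q hp hq => simp [hp, hq]
    | monomial n a h =>
      intro y
      rw [pow_succ, ← mul_assoc, map_mul (aeval (adL x)), map_mul (aeval (adL (_ : 𝔤))), aeval_X,
        aeval_X,
        mul_apply_eq_comp, mul_apply_eq_comp, adL_apply,
        ← adjointGroup_lie hu, h, adL_apply]
  rw [adVariety, mem_ofPred_eq] at hx ⊢
  ext y
  rw [← units_apply_inv_apply u y, h, hx]
  simp

theorem adjointOrbit_subset_adVariety {p : ℂ[X]} {x : 𝔤} (hx : x ∈ adVariety p) :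
    adjointOrbit x ⊆ adVariety p := by
  rintro _ ⟨u, hu, rfl⟩
  exact apply_mem_adVariety hu hx

theorem eval_eq_zero_of_mem_adVariety {p : ℂ[X]} {x y : 𝔤} (hx : x ∈ adVariety p) {μ : ℂ}
    (hy : y ≠ 0) (h : ⁅x, y⁆ = μ • y) : p.eval μ = 0 := by
  have hv : (LieAlgebra.ad ℂ 𝔤 x).HasEigenvector μ y :=
    ⟨Module.End.mem_eigenspace_iff.2 h, hy⟩
  have := Module.End.aeval_apply_of_hasEigenvector (p := p) hv
  rw [mem_adVariety_iff.1 hx] at this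
  simpa [hy] using this.symm

theorem isSemisimple_ad_of_mem_adVariety {p : ℂ[X]} (hp : Squarefree p) {x : 𝔤}
    (hx : x ∈ adVariety p) : (LieAlgebra.ad ℂ 𝔤 x).IsSemisimple :=
  Module.End.isSemisimple_of_squarefree_aeval_eq_zero hp (mem_adVariety_iff.1 hx)

/-- For a semisimple `f` the generalised `0`-eigenspace is the kernel, so `f (f w) = 0` forces `f w
= 0`. -/
theorem isCompl_range_ker_of_mem_adVariety {p : ℂ[X]} (hp : Squarefree p) {x : 𝔤}
    (hx : x ∈ adVariety p) :
    IsCompl (LieAlgebra.ad ℂ 𝔤 x).range (LieAlgebra.ad ℂ 𝔤 x).ker := by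
  set f := LieAlgebra.ad ℂ 𝔤 x with hf
  have hs : f.IsSemisimple := isSemisimple_ad_of_mem_adVariety hp hx
  rw [Submodule.isCompl_iff_disjoint _ _ (by rw [LinearMap.finrank_range_add_finrank_ker])]
  rw [Submodule.disjoint_def]
  rintro _ ⟨w, rfl⟩ hw
  have h2 := hs.isFinitelySemisimple.genEigenspace_eq_eigenspace 0 (k := (2 : ℕ)) (by simp)
  have h3 : w ∈ f.genEigenspace 0 (2 : ℕ) := by
    rw [Module.End.mem_genEigenspace_nat]
    simpa [pow_two] using hw
  rw [h2] at h3
  simpa using Module.End.mem_eigenspace_iff.1 h3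

variable [LieAlgebra.IsSemisimple ℂ 𝔤]

theorem eq_zero_of_forall_lie_eq_zero {z : 𝔤} (h : ∀ y : 𝔤, ⁅z, y⁆ = 0) : z = 0 := by
  have h1 : z ∈ LieAlgebra.center ℂ 𝔤 := by
    rw [LieModule.mem_maxTrivSubmodule]
    intro y
    rw [← lie_skew, h, neg_zero]
  rwa [LieAlgebra.center_eq_bot, LieSubmodule.mem_bot] at h1

/-- A semisimple operator with no eigenvalue but `0` vanishes, so `z` is central, and the centre is
trivial. -/
theorem eq_zero_of_isSemisimple_of_forall_eigenvalue {z : 𝔤}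
    (hz : (LieAlgebra.ad ℂ 𝔤 z).IsSemisimple)
    (h : ∀ μ, (LieAlgebra.ad ℂ 𝔤 z).HasEigenvalue μ → μ = 0) : z = 0 := by
  set f := LieAlgebra.ad ℂ 𝔤 z with hf
  have h1 := Module.End.iSup_maxGenEigenspace_eq_top f
  have h2 : f.eigenspace 0 = ⊤ := by
    rw [eq_top_iff, ← h1]
    refine iSup_le fun μ => ?_
    rw [Module.End.maxGenEigenspace,
      hz.isFinitelySemisimple.genEigenspace_eq_eigenspace μ (by simp)]
    by_cases hμ : f.HasEigenvalue μ
    · rw [h μ hμ]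
    · rw [Module.End.hasEigenvalue_iff, not_not] at hμ
      rw [hμ]; exact bot_le
  refine eq_zero_of_forall_lie_eq_zero fun y => ?_
  have : y ∈ f.eigenspace 0 := h2 ▸ Submodule.mem_top
  simpa [hf] using Module.End.mem_eigenspace_iff.1 this

/-- Two commuting elements of `adVariety p` that are close to each other are equal. -/
theorem exists_forall_eq_zero_of_commute {p : ℂ[X]} (hp : Squarefree p) :
    ∃ ε > 0, ∀ x z : 𝔤, x ∈ adVariety p → x + z ∈ adVariety p → ⁅x, z⁆ = 0 → ‖z‖ < ε →
      z = 0 := by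
  have hp0 : p ≠ 0 := hp.ne_zero
  -- Eigenvalues of `ad z` will turn out to be differences of roots of `p`; the radius `δ` isolates
  -- `0` among these.
  set S : Set ℂ := image2 (· - ·) {a | p.IsRoot a} {a | p.IsRoot a} with hS
  have hfin : {a | p.IsRoot a}.Finite := p.finite_setOfPred_isRoot hp0
  have hSf : S.Finite := hfin.image2 _ hfin
  have hn : (S \ {0})ᶜ ∈ 𝓝 (0 : ℂ) :=
    (hSf.subset sdiff_subset).isClosed.isOpen_compl.mem_nhds (by simp)
  obtain ⟨δ, hδ, hball⟩ := Metric.mem_nhds_iff.1 hn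
  refine ⟨δ / (‖(adL : 𝔤 →L[ℂ] 𝔤 →L[ℂ] 𝔤)‖ + 1), by positivity, fun x z hx hxz hcomm hz => ?_⟩
  have hxs := isSemisimple_ad_of_mem_adVariety hp hx
  have hxzs := isSemisimple_ad_of_mem_adVariety hp hxz
  have hC : Commute (LieAlgebra.ad ℂ 𝔤 x) (LieAlgebra.ad ℂ 𝔤 z) := by
    ext w
    have := leibniz_lie x z w
    rwa [hcomm, zero_lie, zero_add] at this
  have hC' : Commute (LieAlgebra.ad ℂ 𝔤 (x + z)) (LieAlgebra.ad ℂ 𝔤 x) := by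
    rw [map_add]
    exact (Commute.refl _).add_left hC.symm
  have hzs : (LieAlgebra.ad ℂ 𝔤 z).IsSemisimple := by
    have := hxzs.sub_of_commute hC' hxs
    rwa [map_add, add_sub_cancel_left] at this
  refine eq_zero_of_isSemisimple_of_forall_eigenvalue hzs fun μ hμ => ?_
  -- A common eigenvector `w` of `ad x` and `ad z`: then `lam` and `lam + μ` are both roots of `p`.
  set W := (LieAlgebra.ad ℂ 𝔤 z).eigenspace μ with hW
  have hinv : ∀ w ∈ W, LieAlgebra.ad ℂ 𝔤 x w ∈ W := fun w hw =>
    Module.End.mapsTo_genEigenspace_of_comm hC.symm μ 1 hw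
  have : Nontrivial W := (Submodule.nontrivial_iff_ne_bot).2 hμ
  obtain ⟨lam, hlam⟩ := Module.End.exists_eigenvalue ((LieAlgebra.ad ℂ 𝔤 x).restrict hinv)
  obtain ⟨w, hw, hw0⟩ := hlam.exists_hasEigenvector
  have hw1 : ⁅x, (w : 𝔤)⁆ = lam • (w : 𝔤) := by
    have := congrArg Subtype.val (Module.End.mem_eigenspace_iff.1 hw)
    simpa using this
  have hw2 : ⁅z, (w : 𝔤)⁆ = μ • (w : 𝔤) := Module.End.mem_eigenspace_iff.1 w.2
  have hw0' : (w : 𝔤) ≠ 0 := by simpa using hw0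
  have e1 := eval_eq_zero_of_mem_adVariety hx hw0' hw1
  have e2 := eval_eq_zero_of_mem_adVariety hxz hw0' (μ := lam + μ)
    (by rw [add_lie, hw1, hw2, add_smul])
  have hμS : μ ∈ S := ⟨lam + μ, e2, lam, e1, by simp⟩
  have hnorm : ‖μ‖ < δ := by
    have h1 : ‖μ‖ * ‖(w : 𝔤)‖ ≤ ‖(adL : 𝔤 →L[ℂ] 𝔤 →L[ℂ] 𝔤)‖ * ‖z‖ * ‖(w : 𝔤)‖ := by
      rw [← norm_smul, ← hw2, ← adL_apply]
      exact (adL : 𝔤 →L[ℂ] 𝔤 →L[ℂ] 𝔤).le_opNorm₂ z w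
    have h2 := le_of_mul_le_mul_right h1 (norm_pos_iff.2 hw0')
    rw [lt_div_iff₀ (by positivity)] at hz
    nlinarith [norm_nonneg z]
  by_contra hμ0
  exact hball (by simpa using hnorm) ⟨hμS, hμ0⟩

end AdVariety

/-! ### The orbit as a closed embedded complex submanifold -/

section OrbitSlice

open Polynomial Filter

variable {𝔤 : Type*} [NormedLieRing 𝔤] [NormedLieAlgebra ℂ 𝔤] [FiniteDimensional ℂ 𝔤]

theorem contDiff_exp_adL {𝕜 : Type*} [RCLike 𝕜] {A : Type*} [NormedRing A] [NormedAlgebra 𝕜 A]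
    [CompleteSpace A] : ContDiff 𝕜 ω (NormedSpace.exp : A → A) :=
  contDiff_iff_contDiffAt.2 fun x => (NormedSpace.exp_analytic (𝕂 := 𝕜) x).contDiffAt

/-- The projection `π` onto the range of `ad x` along its kernel, and a lift `τ` of it. -/
theorem exists_slice_maps {p : ℂ[X]} (hp : Squarefree p) {x : 𝔤} (hx : x ∈ adVariety p) :
    ∃ π τ : 𝔤 →L[ℂ] 𝔤, (∀ u, ⁅τ u, x⁆ = π u) ∧ (∀ u, ⁅x, u - π u⁆ = 0) ∧
      ∀ u, u ∈ (adL x).range ↔ π u = u := by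
  have hc := isCompl_range_ker_of_mem_adVariety hp hx
  set f := LieAlgebra.ad ℂ 𝔤 x with hf
  -- The lift is taken through `-f` because `⁅τ u, x⁆ = -⁅x, τ u⁆`.
  obtain ⟨t, ht⟩ := Module.projective_lifting_property (-f).rangeRestrict
    ((Submodule.projection f.range f.ker hc).codRestrict (-f).range fun u => by
      obtain ⟨w, hw⟩ := Submodule.projection_apply_mem hc u
      exact ⟨-w, by rw [← hw]; simp⟩) (-f).surjective_rangeRestrict
  refine ⟨LinearMap.toContinuousLinearMap (Submodule.projection f.range f.ker hc),
    LinearMap.toContinuousLinearMap t, fun u => ?_, fun u => ?_, fun u => ?_⟩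
  · have : (-f) (t u) = Submodule.projection f.range f.ker hc u :=
      congrArg Subtype.val (LinearMap.congr_fun ht u)
    rw [LinearMap.neg_apply] at this
    exact (lie_skew (t u) x).symm.trans this
  · have := Submodule.sub_projection_mem hc u
    simpa [hf] using this
  · rw [LinearMap.coe_toContinuousLinearMap', Submodule.projection_eq_self_iff]
    rfl

/-- The slice map at `x`. -/
def sliceMap (π τ : 𝔤 →L[ℂ] 𝔤) (x u : 𝔤) : 𝔤 :=
  NormedSpace.exp (adL (τ u)) (x + (u - π u))

theorem contDiff_sliceMap (π τ : 𝔤 →L[ℂ] 𝔤) (x : 𝔤) : ContDiff ℂ ω (sliceMap π τ x) := by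
  unfold sliceMap
  have h1 : ContDiff ℂ ω fun u : 𝔤 => NormedSpace.exp (adL (τ u)) :=
    contDiff_exp_adL.comp (adL.contDiff.comp τ.contDiff)
  exact h1.clm_apply (by fun_prop)

@[simp] theorem sliceMap_zero (π τ : 𝔤 →L[ℂ] 𝔤) (x : 𝔤) : sliceMap π τ x 0 = x := by
  simp [sliceMap]

/-- The differential is `v ↦ ⁅τ v, x⁆ + (v - π v)`, and the first term is `π v`. -/
theorem hasFDerivAt_sliceMap {π τ : 𝔤 →L[ℂ] 𝔤} {x : 𝔤} (h : ∀ u, ⁅τ u, x⁆ = π u) :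
    HasFDerivAt (sliceMap π τ x) (ContinuousLinearMap.id ℂ 𝔤) 0 := by
  have h0 : HasFDerivAt (NormedSpace.exp : (𝔤 →L[ℂ] 𝔤) → _)
      (1 : (𝔤 →L[ℂ] 𝔤) →L[ℂ] (𝔤 →L[ℂ] 𝔤)) (adL (τ 0)) := by
    simpa using (hasFDerivAt_exp_zero (𝕂 := ℂ) (𝔸 := 𝔤 →L[ℂ] 𝔤))
  have h1 := h0.comp (0 : 𝔤) ((adL.hasFDerivAt).comp (0 : 𝔤) τ.hasFDerivAt)
  have h2 : HasFDerivAt (fun u : 𝔤 => x + (u - π u)) (ContinuousLinearMap.id ℂ 𝔤 - π) 0 :=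
    ((hasFDerivAt_id (0 : 𝔤)).sub π.hasFDerivAt).const_add x
  refine (h1.clm_apply h2).congr_fderiv ?_
  ext v
  simp [h]

variable [LieAlgebra.IsSemisimple ℂ 𝔤]

/-- Near the origin, the slice map meets the orbit exactly in the range of `ad x`. -/
theorem eventually_sliceMap_mem_adjointOrbit {p : ℂ[X]} (hp : Squarefree p) {x H₀ : 𝔤}
    (hx : x ∈ adVariety p) (hH : H₀ ∈ adVariety p) {π τ : 𝔤 →L[ℂ] 𝔤}
    (hπ : ∀ u, ⁅x, u - π u⁆ = 0) :
    ∀ᶠ u in 𝓝 (0 : 𝔤), sliceMap π τ x u ∈ adjointOrbit H₀ ↔ π u = u ∧ x ∈ adjointOrbit H₀ := by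
  obtain ⟨ε, hε, h⟩ := exists_forall_eq_zero_of_commute (𝔤 := 𝔤) hp
  have hc : ContinuousAt (fun u : 𝔤 => ‖u - π u‖) 0 := by fun_prop
  have hlt : ∀ᶠ u in 𝓝 (0 : 𝔤), ‖u - π u‖ < ε :=
    hc.eventually (gt_mem_nhds (by simpa using hε))
  filter_upwards [hlt] with u hu
  rw [sliceMap, exp_adL_apply_mem_adjointOrbit_iff]
  constructor
  · intro hm
    -- Here `x` and `x + (u - π u)` are commuting nearby points of `adVariety p`, so they are equal.
    have h0 := h x _ hx (adjointOrbit_subset_adVariety hH hm) (hπ u) hu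
    rw [h0, add_zero] at hm
    exact ⟨(sub_eq_zero.1 h0).symm, hm⟩
  · rintro ⟨h1, h2⟩
    rw [h1, sub_self, add_zero]
    exact h2

/-- The slice can be taken at a limit point `x` not yet known to be in the orbit. Its image is a
neighbourhood of `x` and so meets the orbit, which forces `x` itself into the orbit. -/
theorem isClosed_adjointOrbit {p : ℂ[X]} (hp : Squarefree p) {H₀ : 𝔤} (hH : H₀ ∈ adVariety p) :
    IsClosed (adjointOrbit H₀) := by
  refine isClosed_of_closure_subset fun x hx => ?_
  have hxp : x ∈ adVariety p :=
    closure_minimal (adjointOrbit_subset_adVariety hH) (isClosed_adVariety p) hx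
  obtain ⟨π, τ, h1, h2, -⟩ := exists_slice_maps hp hxp
  have hD : HasStrictFDerivAt (sliceMap π τ x)
      ((ContinuousLinearEquiv.refl ℂ 𝔤 : 𝔤 ≃L[ℂ] 𝔤) : 𝔤 →L[ℂ] 𝔤) 0 :=
    (contDiff_sliceMap π τ x).contDiffAt.hasStrictFDerivAt' (hasFDerivAt_sliceMap h1) (by simp)
  have hmap := hD.map_nhds_eq_of_equiv
  rw [sliceMap_zero] at hmap
  have hfr : ∃ᶠ y in 𝓝 x, y ∈ adjointOrbit H₀ := mem_closure_iff_frequently.1 hx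
  rw [← hmap, frequently_map] at hfr
  obtain ⟨u, hu, hu'⟩ :=
    (hfr.and_eventually (eventually_sliceMap_mem_adjointOrbit hp hxp hH h2 (τ := τ))).exists
  exact (hu'.1 hu).2

/-- A local analytic diffeomorphism straightening the orbit, inverse to the slice map. -/
theorem exists_straightening {p : ℂ[X]} (hp : Squarefree p) {x H₀ : 𝔤} (hH : H₀ ∈ adVariety p)
    (hx : x ∈ adjointOrbit H₀) :
    ∃ (π τ : 𝔤 →L[ℂ] 𝔤) (G : 𝔤 → 𝔤), (∀ u, ⁅τ u, x⁆ = π u) ∧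
      (∀ u, u ∈ (adL x).range ↔ π u = u) ∧
      ContDiffAt ℂ ω G x ∧ HasFDerivAt G (ContinuousLinearMap.id ℂ 𝔤) x ∧ G x = 0 ∧
      (∀ᶠ u in 𝓝 0, G (sliceMap π τ x u) = u) ∧
      (∀ᶠ y in 𝓝 x, sliceMap π τ x (G y) = y) ∧
      ∀ᶠ y in 𝓝 x, y ∈ adjointOrbit H₀ ↔ G y ∈ (adL x).range := by
  have hxp := adjointOrbit_subset_adVariety hH hx
  obtain ⟨π, τ, h1, h2, h3⟩ := exists_slice_maps hp hxp
  have hc : ContDiffAt ℂ ω (sliceMap π τ x) 0 := (contDiff_sliceMap π τ x).contDiffAt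
  have hD' : HasFDerivAt (sliceMap π τ x)
    ((ContinuousLinearEquiv.refl ℂ 𝔤 : 𝔤 ≃L[ℂ] 𝔤) : 𝔤 →L[ℂ] 𝔤) 0 := hasFDerivAt_sliceMap h1
  have hω : (ω : WithTop ℕ∞) ≠ 0 := by simp
  have hD := hc.hasStrictFDerivAt' hD' hω
  have hG := hc.to_localInverse hD' hω
  have hG0 := hc.localInverse_apply_image hD' hω
  have hGD : HasFDerivAt (hc.localInverse hD' hω) _ _ := hD.to_localInverse.hasFDerivAt
  have hl := hD.eventually_left_inverse
  have hr := hD.eventually_right_inverse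
  rw [sliceMap_zero] at hG hG0 hGD hr
  refine ⟨π, τ, hc.localInverse hD' hω, h1, h3, hG, hGD, hG0, hl, hr, ?_⟩
  have ht : Tendsto (hc.localInverse hD' hω) (𝓝 x) (𝓝 0) := by
    have := hG.continuousAt
    rwa [ContinuousAt, hG0] at this
  filter_upwards [hr, ht.eventually (eventually_sliceMap_mem_adjointOrbit hp hxp hH h2 (τ := τ))]
    with y hy hy'
  rw [h3]
  constructor
  · intro hm
    have e : sliceMap π τ x (hc.localInverse hD' hω y) = y := hy
    rw [e] at hy'
    exact (hy'.1 hm).1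
  · intro hm
    have e : sliceMap π τ x (hc.localInverse hD' hω y) = y := hy
    rw [e] at hy'
    exact hy'.2 ⟨hm, hx⟩

theorem tangentSpaceAt_adjointOrbit {p : ℂ[X]} (hp : Squarefree p) {x H₀ : 𝔤}
    (hH : H₀ ∈ adVariety p) (hx : x ∈ adjointOrbit H₀) :
    tangentSpaceAt (adjointOrbit H₀) x = (adL x).range.restrictScalars ℝ := by
  have : FiniteDimensional ℝ 𝔤 := FiniteDimensional.complexToReal 𝔤
  obtain ⟨π, τ, G, -, -, hG, hGD, -, -, -, hm⟩ := exists_straightening hp hH hx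
  exact tangentSpaceAt_eq
    ((hG.hasStrictFDerivAt' hGD (by simp)).restrictScalars ℝ) hx hm

theorem range_adL_apply {u : (𝔤 →L[ℂ] 𝔤)ˣ} (hu : u ∈ adjointGroup 𝔤) (x : 𝔤) :
    (adL ((u : 𝔤 →L[ℂ] 𝔤) x)).range =
      (adL x).range.map ((ContinuousLinearEquiv.unitsEquiv ℂ 𝔤 u).toLinearEquiv : 𝔤 →ₗ[ℂ] 𝔤) := by
  ext y
  simp only [LinearMap.mem_range, Submodule.mem_map]
  constructor
  · rintro ⟨w, rfl⟩
    refine ⟨_, ⟨(↑u⁻¹ : 𝔤 →L[ℂ] 𝔤) w, rfl⟩, ?_⟩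
    have := adjointGroup_lie hu x ((↑u⁻¹ : 𝔤 →L[ℂ] 𝔤) w)
    rw [units_apply_inv_apply] at this
    exact this
  · rintro ⟨_, ⟨w, rfl⟩, rfl⟩
    exact ⟨(u : 𝔤 →L[ℂ] 𝔤) w, (adjointGroup_lie hu x w).symm⟩

theorem finrank_range_adL_of_mem_adjointOrbit {x H₀ : 𝔤} (hx : x ∈ adjointOrbit H₀) :
    Module.finrank ℂ (adL x).range = Module.finrank ℂ (adL H₀).range := by
  obtain ⟨u, hu, rfl⟩ := hx
  rw [range_adL_apply hu]
  exact LinearEquiv.finrank_map_eq _ _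

theorem isSubmanifold_adjointOrbit {p : ℂ[X]} (hp : Squarefree p) {H₀ : 𝔤}
    (hH : H₀ ∈ adVariety p) :
    IsSubmanifold ℂ (Module.finrank ℂ (adL H₀).range) (adjointOrbit H₀) := by
  intro x hx
  obtain ⟨π, τ, G, -, -, hG, hGD, -, -, -, hm⟩ := exists_straightening hp hH hx
  obtain ⟨φ, hφ, -⟩ := exists_isSliceChart hG hGD hx hm
  exact ⟨_, φ, finrank_range_adL_of_mem_adjointOrbit hx, hφ⟩

end OrbitSlice

/-! ### Regular elements and weights of a Cartan subalgebra -/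

section Cartan

open Polynomial LieAlgebra

variable {𝔤 : Type*} [NormedLieRing 𝔤] [NormedLieAlgebra ℂ 𝔤] [FiniteDimensional ℂ 𝔤]
  [LieAlgebra.IsSemisimple ℂ 𝔤] {𝔥 : LieSubalgebra ℂ 𝔤} [𝔥.IsCartanSubalgebra]

theorem lie_eq_zero_of_mem_cartan {x y : 𝔤} (hx : x ∈ 𝔥) (hy : y ∈ 𝔥) : ⁅x, y⁆ = 0 :=
  congrArg Subtype.val (trivial_lie_zero 𝔥 𝔥 ⟨x, hx⟩ ⟨y, hy⟩)

/-- A squarefree polynomial annihilating `ad x`, for `x` in a Cartan subalgebra. -/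
theorem exists_squarefree_mem_adVariety {x : 𝔤} (hx : x ∈ 𝔥) :
    ∃ p : ℂ[X], Squarefree p ∧ x ∈ adVariety p :=
  ⟨_, (IsKilling.isSemisimple_ad_of_mem_isCartanSubalgebra hx).minpoly_squarefree,
    mem_adVariety_iff.2 (minpoly.aeval ℂ _)⟩

/-- Regularity makes `ad H` invertible on every root space, so `𝔤 = 𝔥 + range (ad H)`. The component
of `x` in the range also lies in the kernel, and these two meet trivially as `ad H` is semisimple.
-/
theorem mem_cartan_of_lie_eq_zero {H : 𝔥} (hH : IsRegularElement H) {x : 𝔤}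
    (hx : ⁅(H : 𝔤), x⁆ = 0) : x ∈ 𝔥 := by
  obtain ⟨p, hp, hHp⟩ := exists_squarefree_mem_adVariety H.2
  have hc := isCompl_range_ker_of_mem_adVariety hp hHp
  set f := ad ℂ 𝔤 (H : 𝔤) with hf
  have htop : (⊤ : Submodule ℂ 𝔤) ≤ 𝔥.toSubmodule ⊔ f.range := by
    have h1 := LieModule.iSup_genWeightSpace_eq_top' ℂ 𝔥 𝔤
    rw [← LieSubmodule.toSubmodule_inj, LieSubmodule.iSup_toSubmodule,
      LieSubmodule.top_toSubmodule] at h1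
    rw [← h1]
    refine iSup_le fun α => ?_
    by_cases hα : α.IsZero
    · refine le_trans ?_ le_sup_left
      have := rootSpace_zero_eq ℂ 𝔤 𝔥
      rw [hα.eq]
      intro y hy
      have hy' : y ∈ rootSpace 𝔥 (0 : 𝔥 → ℂ) := hy
      rw [this] at hy'
      exact hy'
    · refine le_trans (fun y hy => ?_) le_sup_right
      have h2 : α ∈ 𝔥.root := by simpa using hα
      have h3 := IsKilling.lie_eq_smul_of_mem_rootSpace (show y ∈ rootSpace 𝔥 α from hy) H
      have h4 := hH α h2
      refine ⟨(α H)⁻¹ • y, ?_⟩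
      have h5 : ⁅(H : 𝔤), y⁆ = α H • y := h3
      rw [map_smul, hf, ad_apply, h5, smul_smul, inv_mul_cancel₀ h4, one_smul]
  obtain ⟨h, hh, r, hr, hhr⟩ := Submodule.mem_sup.1 (htop (Submodule.mem_top (x := x)))
  have hr0 : r ∈ f.ker := by
    have e : r = x - h := by rw [← hhr]; simp
    rw [LinearMap.mem_ker, e, map_sub, hf, ad_apply, ad_apply, hx,
      lie_eq_zero_of_mem_cartan H.2 hh, sub_zero]
  have := (Submodule.disjoint_def.1 hc.disjoint) r hr hr0
  rw [← hhr, this, add_zero]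
  exact hh

theorem exists_rootVector (α : LieModule.Weight ℂ 𝔥 𝔤) :
    ∃ y : 𝔤, y ≠ 0 ∧ ∀ h : 𝔥, ⁅(h : 𝔤), y⁆ = α h • y := by
  obtain ⟨y, hy, hy0⟩ := α.exists_ne_zero
  refine ⟨y, hy0, fun h => ?_⟩
  have := IsKilling.lie_eq_smul_of_mem_rootSpace hy h
  exact this

/-- An element of `𝔥` is determined by its weights, and here each weight takes a value among the
roots of `p`. -/
theorem finite_cartan_inter_adVariety {p : ℂ[X]} (hp : p ≠ 0) :
    {x : 𝔤 | x ∈ 𝔥 ∧ x ∈ adVariety p}.Finite := by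
  have hfin : {a | p.IsRoot a}.Finite := p.finite_setOfPred_isRoot hp
  have h1 : (Set.pi univ fun _ : LieModule.Weight ℂ 𝔥 𝔤 => {a | p.IsRoot a}).Finite :=
    Set.Finite.pi fun _ => hfin
  have h2 : {h : 𝔥 | (h : 𝔤) ∈ adVariety p}.Finite := by
    refine Set.Finite.of_injOn (f := fun (h : 𝔥) (α : LieModule.Weight ℂ 𝔥 𝔤) => α h)
      (fun h hh => ?_) (fun h _ h' _ heq => ?_) h1
    · intro α _
      obtain ⟨y, hy0, hy⟩ := exists_rootVector α
      have hh' : (h : 𝔤) ∈ adVariety p := hh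
      have h5 : p.eval (α h) = 0 := eval_eq_zero_of_mem_adVariety hh' hy0 (hy h)
      exact h5
    · have h3 : h - h' ∈ ⨅ α : LieModule.Weight ℂ 𝔥 𝔤, α.ker := by
        rw [Submodule.mem_iInf]
        intro α
        have := congrFun heq α
        simp only at this
        rw [LinearMap.mem_ker, map_sub, sub_eq_zero]
        exact this
      rw [IsKilling.iInf_ker_weight_eq_bot, Submodule.mem_bot] at h3
      exact sub_eq_zero.1 h3
  refine (h2.image (Subtype.val : 𝔥 → 𝔤)).subset ?_
  rintro x ⟨hx, hxp⟩
  exact ⟨⟨x, hx⟩, hxp, rfl⟩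

end Cartan

/-! ### Critical points of the height function -/

section HeightFunction

open Polynomial Filter

variable {𝔤 : Type*} [NormedLieRing 𝔤] [NormedLieAlgebra ℂ 𝔤] [FiniteDimensional ℂ 𝔤]

/-- The height function as a continuous linear map. -/
def heightL (H : 𝔤) : 𝔤 →L[ℂ] ℂ := LinearMap.toContinuousLinearMap (killingForm ℂ 𝔤 H)

theorem coe_heightL (H : 𝔤) : ⇑(heightL H) = heightFunction H := rfl

theorem killingForm_lie (x y z : 𝔤) : killingForm ℂ 𝔤 ⁅x, y⁆ z = killingForm ℂ 𝔤 x ⁅y, z⁆ :=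
  LieModule.traceForm_apply_lie_apply ℂ 𝔤 𝔤 x y z

theorem killingForm_symm (x y : 𝔤) : killingForm ℂ 𝔤 x y = killingForm ℂ 𝔤 y x :=
  LieModule.traceForm_comm ℂ 𝔤 𝔤 x y

theorem fderiv_heightFunction (H x v : 𝔤) :
    fderiv ℝ (heightFunction H) x v = heightFunction H v := by
  rw [← coe_heightL]
  have := ((heightL H).restrictScalars ℝ).hasFDerivAt (x := x)
  exact DFunLike.congr_fun this.fderiv v

variable [LieAlgebra.IsSemisimple ℂ 𝔤]

theorem eq_zero_of_forall_killingForm {x : 𝔤} (h : ∀ y, killingForm ℂ 𝔤 x y = 0) : x = 0 :=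
  (LieAlgebra.IsKilling.killingForm_nondegenerate ℂ 𝔤).1 x h

/-- Invariance turns `⟨H, [x, y]⟩` into `⟨[H, x], y⟩`, and the Killing form is nondegenerate. -/
theorem forall_range_heightFunction_eq_zero_iff {H x : 𝔤} :
    (∀ v ∈ (adL x).range, heightFunction H v = 0) ↔ ⁅H, x⁆ = 0 := by
  constructor
  · intro h
    refine eq_zero_of_forall_killingForm fun y => ?_
    rw [killingForm_lie]
    exact h _ ⟨y, rfl⟩
  · rintro h _ ⟨y, rfl⟩
    have := killingForm_lie H x y
    rw [h, map_zero, LinearMap.zero_apply] at this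
    exact this.symm

theorem mem_criticalPoints_iff {p : ℂ[X]} (hp : Squarefree p) {H₀ : 𝔤} (hH₀ : H₀ ∈ adVariety p)
    {H x : 𝔤} : x ∈ criticalPoints (adjointOrbit H₀) (heightFunction H) ↔
      x ∈ adjointOrbit H₀ ∧ ⁅H, x⁆ = 0 := by
  refine and_congr_right fun hx => ?_
  rw [tangentSpaceAt_adjointOrbit hp hH₀ hx, ← forall_range_heightFunction_eq_zero_iff]
  simp only [fderiv_heightFunction, Submodule.restrictScalars_mem]

theorem finite_criticalPoints {𝔥 : LieSubalgebra ℂ 𝔤} [𝔥.IsCartanSubalgebra] {p : ℂ[X]}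
    (hp : Squarefree p) {H₀ : 𝔤} (hH₀ : H₀ ∈ adVariety p) {H : 𝔥} (hH : IsRegularElement H) :
    (criticalPoints (adjointOrbit H₀) (heightFunction (H : 𝔤))).Finite := by
  refine (finite_cartan_inter_adVariety (𝔥 := 𝔥) hp.ne_zero).subset fun x hx => ?_
  rw [mem_criticalPoints_iff hp hH₀] at hx
  exact ⟨mem_cartan_of_lie_eq_zero hH hx.2, adjointOrbit_subset_adVariety hH₀ hx.1⟩

end HeightFunction

/-! ### Nondegeneracy of the Hessian -/

section Hessian

open Polynomial Filter

/-- The second derivative on the diagonal of `ℓ ∘ exp ∘ T`, for linear maps `ℓ` and `T`. -/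
theorem fderiv_fderiv_exp_comp {W A : Type*} [NormedAddCommGroup W] [NormedSpace ℂ W]
    [NormedRing A] [NormedAlgebra ℂ A] [CompleteSpace A] (T : W →L[ℂ] A) (l : A →L[ℂ] ℂ) (v : W) :
    fderiv ℂ (fderiv ℂ fun u => l (NormedSpace.exp (T u))) 0 v v = l (T v * T v) := by
  set g : W → ℂ := fun u => l (NormedSpace.exp (T u)) with hg
  have hgs : ContDiff ℂ ω g := l.contDiff.comp (contDiff_exp_adL.comp T.contDiff)
  have hline : ∀ t : ℂ, HasDerivAt (fun t : ℂ => t • v) v t := fun t => by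
    simpa using (hasDerivAt_id t).smul_const v
  -- Along the line `t ↦ t v` the function is `l` of a one-parameter group, which is differentiated
  -- twice.
  have h1 : ∀ t : ℂ, fderiv ℂ g (t • v) v = l (NormedSpace.exp (t • T v) * T v) := by
    intro t
    have e0 : DifferentiableAt ℂ g (t • v) := hgs.differentiable (by simp) _
    have e1 : HasDerivAt (fun t : ℂ => g (t • v)) (fderiv ℂ g (t • v) v) t :=
      e0.hasFDerivAt.comp_hasDerivAt_of_eq t (hline t) rfl
    have e2 : HasDerivAt (fun t : ℂ => g (t • v)) (l (NormedSpace.exp (t • T v) * T v)) t := by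
      simp only [hg, map_smul]
      exact l.hasFDerivAt.comp_hasDerivAt t (hasDerivAt_exp_smul_const (T v) t)
    exact e1.unique e2
  have hg1 : ContDiff ℂ 1 (fderiv ℂ g) := hgs.fderiv_right le_top
  have hd : DifferentiableAt ℂ (fderiv ℂ g) ((0 : ℂ) • v) := hg1.differentiable (by simp) _
  have e1 : HasDerivAt (fun t : ℂ => fderiv ℂ g (t • v) v)
      (fderiv ℂ (fderiv ℂ g) ((0 : ℂ) • v) v v) 0 := by
    have := (hd.hasFDerivAt.comp_hasDerivAt_of_eq (0 : ℂ) (hline 0) rfl).clm_apply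
      (hasDerivAt_const 0 v)
    simpa using this
  have e2 : HasDerivAt (fun t : ℂ => fderiv ℂ g (t • v) v) (l (T v * T v)) 0 := by
    simp only [h1]
    have := l.hasFDerivAt.comp_hasDerivAt (0 : ℂ)
      ((hasDerivAt_exp_smul_const (T v) (0 : ℂ)).mul_const (T v))
    simpa using! this
  simpa using e1.unique e2

variable {𝔤 : Type*} [NormedLieRing 𝔤] [NormedLieAlgebra ℂ 𝔤] [FiniteDimensional ℂ 𝔤]
  [LieAlgebra.IsSemisimple ℂ 𝔤] {𝔥 : LieSubalgebra ℂ 𝔤} [𝔥.IsCartanSubalgebra]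

/-- The Hessian is `(a, b) ↦ ⟨[H, τ a], b⟩`. Testing a radical vector `v` against all `b = [x, y]`
gives `[[H, τ v], x] = 0`. Since `v = [τ v, x]` and `[H, x] = 0`, also `[H, v] = 0`. Hence `v` and
`x` both lie in `𝔥` and commute, so `v` is in the kernel and the range of `ad x`. -/
theorem hessianNondegenerate_of_lie_eq_zero {p : ℂ[X]} (hp : Squarefree p) {H₀ x : 𝔤}
    (hH₀ : H₀ ∈ adVariety p) (hx : x ∈ adjointOrbit H₀) {H : 𝔥} (hH : IsRegularElement H)
    (hHx : ⁅(H : 𝔤), x⁆ = 0) :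
    HessianNondegenerate (adjointOrbit H₀) (heightFunction (H : 𝔤)) x := by
  obtain ⟨π, τ, G, hτ, hπ, hG, hGD, hG0, hGl, -, hm⟩ := exists_straightening hp hH₀ hx
  obtain ⟨φ, hφ, hφG⟩ := exists_isSliceChart hG hGD hx hm
  set V := (adL x).range with hV
  refine ⟨V, φ, hφ, fun v hv => ?_⟩
  have hφx : φ x = 0 := by rw [hφG, hG0]
  set T : V →L[ℂ] (𝔤 →L[ℂ] 𝔤) := adL ∘L τ ∘L V.subtypeL with hT
  set l : (𝔤 →L[ℂ] 𝔤) →L[ℂ] ℂ :=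
    heightL (H : 𝔤) ∘L ContinuousLinearMap.apply ℂ 𝔤 x with hl
  set g : V → ℂ := fun u => l (NormedSpace.exp (T u)) with hg
  have hτV : ∀ w : V, ⁅τ w, x⁆ = (w : 𝔤) := fun w => by rw [hτ]; exact (hπ w).1 w.2
  -- On `V` the projection `π` is the identity, so the inverse chart is `u ↦ exp (ad (τ u)) x`.
  have hloc : (fun u : V => heightFunction (H : 𝔤) (φ.symm (φ x + (u : 𝔤)))) =ᶠ[𝓝 0] g := by
    have hs : ∀ᶠ u in 𝓝 (0 : 𝔤), sliceMap π τ x u ∈ φ.source := by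
      have hc := (contDiff_sliceMap π τ x).continuous.continuousAt (x := 0)
      refine hc.eventually (φ.open_source.mem_nhds ?_)
      rw [sliceMap_zero]; exact hφ.mem_source
    have ht : Tendsto (fun u : V => (u : 𝔤)) (𝓝 0) (𝓝 0) := by
      have := (V.subtypeL.continuous).tendsto 0
      simpa using! this
    filter_upwards [ht.eventually (hs.and hGl)] with u hu
    have e1 : φ.symm (φ x + (u : 𝔤)) = sliceMap π τ x u := by
      rw [hφx, zero_add]
      have := φ.left_inv hu.1
      rwa [hφG, hu.2] at this
    rw [e1, sliceMap, (hπ u).1 u.2, sub_self, add_zero]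
    rfl
  have hD := (hloc.fderiv (𝕜 := ℂ)).fderiv_eq (𝕜 := ℂ)
  rw [hD] at hv
  set D := fderiv ℂ (fderiv ℂ g) 0 with hDdef
  have hgs : ContDiff ℂ ω g := l.contDiff.comp (contDiff_exp_adL.comp T.contDiff)
  have hsymm : ∀ a b, D a b = D b a := fun a b =>
    hgs.contDiffAt.isSymmSndFDerivAt (by simp) a b
  have hdiag : ∀ a, D a a = l (T a * T a) := fun a => fderiv_fderiv_exp_comp T l a
  have hTT : ∀ a b, l (T a * T b) = killingForm ℂ 𝔤 ⁅(H : 𝔤), τ a⁆ b := fun a b => by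
    have : l (T a * T b) = killingForm ℂ 𝔤 (H : 𝔤) ⁅τ a, ⁅τ b, x⁆⁆ := rfl
    rw [this, hτV, killingForm_lie]
  have hkey : ∀ a b : 𝔤, killingForm ℂ 𝔤 ⁅(H : 𝔤), a⁆ ⁅b, x⁆ =
      killingForm ℂ 𝔤 ⁅(H : 𝔤), b⁆ ⁅a, x⁆ := fun a b => by
    have e1 : ⁅(H : 𝔤), ⁅x, a⁆⁆ = ⁅x, ⁅(H : 𝔤), a⁆⁆ := by
      rw [leibniz_lie, hHx, zero_lie, zero_add]
    rw [killingForm_symm, killingForm_lie, ← e1, ← killingForm_lie, ← lie_skew b (H : 𝔤),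
      ← lie_skew x a]
    simp only [map_neg, LinearMap.neg_apply, neg_neg]
  have hTsymm : ∀ a b, l (T a * T b) = l (T b * T a) := fun a b => by
    have := hkey (τ a) (τ b)
    rwa [hτV, hτV, ← hTT, ← hTT] at this
  -- Both bilinear forms are symmetric and agree on the diagonal; polarise.
  have hDT : ∀ a b, D a b = l (T a * T b) := fun a b => by
    have h1 := hdiag (a + b)
    simp only [map_add, add_apply, add_mul, mul_add, hdiag] at h1
    rw [hsymm b a, hTsymm b a] at h1
    linear_combination h1 / 2
  have h0 : ⁅⁅(H : 𝔤), τ v⁆, x⁆ = 0 := by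
    refine eq_zero_of_forall_killingForm fun y => ?_
    rw [killingForm_lie]
    have := hv ⟨⁅x, y⁆, ⟨y, rfl⟩⟩
    rw [hDT, hTT] at this
    exact this
  have h1 : ⁅(H : 𝔤), (v : 𝔤)⁆ = 0 := by
    rw [← hτV v, leibniz_lie, h0, hHx, lie_zero, zero_add]
  have hxh : x ∈ 𝔥 := mem_cartan_of_lie_eq_zero hH hHx
  have hvh : (v : 𝔤) ∈ 𝔥 := mem_cartan_of_lie_eq_zero hH h1
  have hc := isCompl_range_ker_of_mem_adVariety hp (adjointOrbit_subset_adVariety hH₀ hx)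
  have := (Submodule.disjoint_def.1 hc.disjoint) v v.2 (by
    rw [LinearMap.mem_ker, LieAlgebra.ad_apply]; exact lie_eq_zero_of_mem_cartan hxh hvh)
  exact Subtype.ext this

end Hessian

/-! ### A constant Kähler form -/

section KahlerForm

variable {E : Type*} [NormedAddCommGroup E] [NormedSpace ℂ E] [FiniteDimensional ℂ E]

/-- A linear isomorphism onto a complex Euclidean space, used to define a Hermitian product. -/
def hermEquiv (E : Type*) [NormedAddCommGroup E] [NormedSpace ℂ E] [FiniteDimensional ℂ E] :
    E ≃L[ℂ] EuclideanSpace ℂ (Fin (Module.finrank ℂ E)) :=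
  ContinuousLinearEquiv.ofFinrankEq (by simp)

/-- The imaginary part of a Hermitian inner product. -/
def kahlerForm (E : Type*) [NormedAddCommGroup E] [NormedSpace ℂ E] [FiniteDimensional ℂ E] :
    E [⋀^Fin 2]→L[ℝ] ℝ where
  toFun m := (inner ℂ (hermEquiv E (m 0)) (hermEquiv E (m 1))).im
  map_update_add' m i x y := by
    fin_cases i <;> simp
  map_update_smul' m i c x := by
    have h : ∀ z : E, hermEquiv E (c • z) = (c : ℂ) • hermEquiv E z := fun z => by
      rw [← map_smul]; rfl
    fin_cases i <;> simp [h]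
  map_eq_zero_of_eq' m i j hij hne := by
    have h : m 0 = m 1 := by
      fin_cases i <;> fin_cases j <;> simp_all
    rw [h]
    exact inner_self_im (𝕜 := ℂ) _
  cont := by fun_prop

theorem kahlerForm_apply (v w : E) :
    kahlerForm E ![v, w] = (inner ℂ (hermEquiv E v) (hermEquiv E w)).im := rfl

/-- The imaginary part of the Hermitian product of `v` with `I v` is the squared Hermitian norm of
`v`. -/
theorem eq_zero_of_kahlerForm {v : E} (h : kahlerForm E ![v, Complex.I • v] = 0) : v = 0 := by
  rw [kahlerForm_apply, map_smul, inner_smul_right, inner_self_eq_norm_sq_to_K] at h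
  have h' : ‖hermEquiv E v‖ ^ 2 = 0 := by
    simpa [← Complex.ofReal_pow] using h
  have h'' : hermEquiv E v = 0 := by simpa using h'
  exact (map_eq_zero_iff _ (hermEquiv E).injective).1 h''

/-- The Kähler form is nondegenerate along sets whose tangent space is complex. -/
theorem nondegenerateOnTangent_kahlerForm {N : Set E} {x : E} {V : Submodule ℂ E}
    (h : tangentSpaceAt N x = V.restrictScalars ℝ) :
    NondegenerateOnTangent (fun _ => kahlerForm E) N x := by
  intro v hv hvw
  rw [h] at hv hvw
  exact eq_zero_of_kahlerForm (hvw _ (V.smul_mem Complex.I hv))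

/-- A form with constant coefficients is closed, so only nondegeneracy uses the complex tangent
spaces. -/
theorem isSymplecticForm_kahlerForm {M : Set E}
    (h : ∀ x ∈ M, ∃ V : Submodule ℂ E, tangentSpaceAt M x = V.restrictScalars ℝ) :
    IsSymplecticForm M fun _ => kahlerForm E := by
  refine ⟨fun x hx => ?_, fun x _ => ⟨univ, fun _ => kahlerForm E, isOpen_univ, trivial,
    contDiffOn_const, fun _ _ _ _ _ _ => rfl, fun y _ u _ v _ w _ => ?_⟩⟩
  · obtain ⟨V, hV⟩ := h x hx
    exact nondegenerateOnTangent_kahlerForm hV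
  · rw [extDeriv_apply (differentiableAt_const _)]
    simp

theorem AffineSubspace.isSymplecticSubmanifold_kahlerForm {M : Set E} (A : AffineSubspace ℂ E)
    (hA : (A : Set E) ⊆ M) :
    IsSymplecticSubmanifold M (fun _ => kahlerForm E) (A : Set E) :=
  ⟨hA, A.isSubmanifold_real, fun _ hx =>
    nondegenerateOnTangent_kahlerForm (A.tangentSpaceAt_eq hx)⟩

theorem finrank_inf_ker_add_one {W : Submodule ℂ E} {f : E →L[ℂ] ℂ}
    (h : ∃ e ∈ W, f e ≠ 0) :
    Module.finrank ℂ (W ⊓ (f : E →ₗ[ℂ] ℂ).ker : Submodule ℂ E) + 1 = Module.finrank ℂ W := by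
  obtain ⟨e, he, hfe⟩ := h
  set g := (f : E →ₗ[ℂ] ℂ).domRestrict W with hg
  have hs : Function.Surjective g := by
    intro c
    refine ⟨(c / f e) • ⟨e, he⟩, ?_⟩
    have : g ⟨e, he⟩ = f e := rfl
    rw [map_smul, this, smul_eq_mul, div_mul_cancel₀ _ hfe]
  have h1 := g.finrank_range_add_finrank_ker
  rw [LinearMap.range_eq_top.2 hs, finrank_top, Module.finrank_self] at h1
  have h2 : g.ker = (f : E →ₗ[ℂ] ℂ).ker.comap W.subtype := by
    rw [hg, LinearMap.ker_domRestrict]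
  rw [← Submodule.map_comap_subtype, Submodule.finrank_map_subtype_eq, ← h2, ← h1, add_comm]

end KahlerForm

/-! ### Regular fibres as symplectic submanifolds -/

section RegularFibres

open Polynomial Filter

variable {𝔤 : Type*} [NormedLieRing 𝔤] [NormedLieAlgebra ℂ 𝔤] [FiniteDimensional ℂ 𝔤]
  [LieAlgebra.IsSemisimple ℂ 𝔤]

/-- Near a noncritical point the fibre of the height function is straightened by a local
analytic diffeomorphism. -/
theorem exists_straightening_fibre {p : ℂ[X]} (hp : Squarefree p) {H₀ H x : 𝔤} {c : ℂ}
    (hH₀ : H₀ ∈ adVariety p)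
    (hx : x ∈ fibre (adjointOrbit H₀) (heightFunction H) c) (hHx : ⁅H, x⁆ ≠ 0) :
    ∃ G : 𝔤 → 𝔤, ContDiffAt ℂ ω G x ∧ HasFDerivAt G (ContinuousLinearMap.id ℂ 𝔤) x ∧
      (∀ᶠ y in 𝓝 x, y ∈ fibre (adjointOrbit H₀) (heightFunction H) c ↔
        G y ∈ (adL x).range ⊓ (heightL H : 𝔤 →ₗ[ℂ] ℂ).ker) ∧
      Module.finrank ℂ ((adL x).range ⊓ (heightL H : 𝔤 →ₗ[ℂ] ℂ).ker : Submodule ℂ 𝔤) + 1 =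
        Module.finrank ℂ (adL H₀).range := by
  obtain ⟨π, τ, G, -, -, hG, hGD, -, -, -, hm⟩ := exists_straightening hp hH₀ hx.1
  have hex : ∃ e ∈ (adL x).range, heightL H e ≠ 0 := by
    by_contra! hcon
    exact hHx (forall_range_heightFunction_eq_zero_iff.1 hcon)
  have hfin := finrank_inf_ker_add_one hex
  rw [finrank_range_adL_of_mem_adjointOrbit hx.1] at hfin
  obtain ⟨e', he', hfe'⟩ := hex
  set f := heightL H with hf
  set e := (f e')⁻¹ • e' with he
  have heV : e ∈ (adL x).range := Submodule.smul_mem _ _ he'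
  have hfe : f e = 1 := by rw [he, map_smul, smul_eq_mul, inv_mul_cancel₀ hfe']
  -- The correction along `e`, with `f e = 1`, makes `f` of the new coordinate equal to `f y - c`.
  -- It has zero derivative at `x`, and since `e` is in the range it does not affect membership in
  -- the range.
  refine ⟨fun y => G y + (f y - c - f (G y)) • e, by fun_prop, ?_, ?_, hfin⟩
  · have h1 : HasFDerivAt (fun y => f y - c - f (G y))
        (f - f ∘L ContinuousLinearMap.id ℂ 𝔤) x :=
      (f.hasFDerivAt.sub_const c).sub (f.hasFDerivAt.comp x hGD)
    refine (hGD.add (h1.smul_const e)).congr_fderiv ?_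
    ext v
    simp
  · filter_upwards [hm] with y hy
    rw [fibre, mem_ofPred_eq, hy, Submodule.mem_inf,
      Submodule.add_mem_iff_left _ (Submodule.smul_mem _ _ heV)]
    refine and_congr_right fun _ => ?_
    rw [LinearMap.mem_ker, ContinuousLinearMap.coe_coe, map_add, map_smul, hfe, smul_eq_mul,
      mul_one, ← coe_heightL, ← sub_eq_zero, ← hf, add_sub_cancel]

theorem isSymplecticSubmanifold_fibre {p : ℂ[X]} (hp : Squarefree p) {H₀ H : 𝔤} {c : ℂ}
    (hH₀ : H₀ ∈ adVariety p)
    (hc : IsRegularValue (adjointOrbit H₀) (heightFunction H) c) :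
    IsSymplecticSubmanifold (adjointOrbit H₀) (fun _ => kahlerForm 𝔤)
      (fibre (adjointOrbit H₀) (heightFunction H) c) := by
  have hreg : ∀ x ∈ fibre (adjointOrbit H₀) (heightFunction H) c, ⁅H, x⁆ ≠ 0 := by
    intro x hx h0
    exact hc ⟨x, (mem_criticalPoints_iff hp hH₀).2 ⟨hx.1, h0⟩, hx.2⟩
  have : FiniteDimensional ℝ 𝔤 := FiniteDimensional.complexToReal 𝔤
  -- At a point of the fibre the complex rank is at least one, so the truncated subtraction is
  -- harmless.
  refine ⟨fun x hx => hx.1, ⟨2 * (Module.finrank ℂ (adL H₀).range - 1), fun x hx => ?_⟩,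
    fun x hx => ?_⟩
  · obtain ⟨G, hG, hGD, hm, hfin⟩ := exists_straightening_fibre hp hH₀ hx (hreg x hx)
    obtain ⟨φ, hφ, -⟩ := exists_isSliceChart (𝕜 := ℝ)
      (V := ((adL x).range ⊓ (heightL H : 𝔤 →ₗ[ℂ] ℂ).ker).restrictScalars ℝ)
      (hG.restrict_scalars ℝ) (hGD.restrictScalars ℝ) hx hm
    refine ⟨_, φ, ?_, hφ⟩
    rw [← hfin, Nat.add_sub_cancel]
    exact finrank_real_of_complex
      ((adL x).range ⊓ (heightL H : 𝔤 →ₗ[ℂ] ℂ).ker : Submodule ℂ 𝔤)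
  · obtain ⟨G, hG, hGD, hm, hfin⟩ := exists_straightening_fibre hp hH₀ hx (hreg x hx)
    exact nondegenerateOnTangent_kahlerForm (tangentSpaceAt_eq
      (V := ((adL x).range ⊓ (heightL H : 𝔤 →ₗ[ℂ] ℂ).ker).restrictScalars ℝ)
      ((hG.hasStrictFDerivAt' hGD (by simp)).restrictScalars ℝ) hx hm)

end RegularFibres

/-! ### Truncating the exponential series modulo a subspace -/

section ExpSubmodule

variable {E : Type*} [NormedAddCommGroup E] [NormedSpace ℂ E] [FiniteDimensional ℂ E]

/-- From order `m` on, every term of the series lies in `S`, which is closed. This replaces `exp` by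
a few terms modulo a deeper step of a filtration. -/
theorem exp_apply_sub_mem {D : E →L[ℂ] E} {S : Submodule ℂ E} (hS : ∀ w ∈ S, D w ∈ S) {w : E}
    {m : ℕ} (hw : (D ^ m) w ∈ S) :
    NormedSpace.exp D w - ∑ j ∈ Finset.range m, ((j.factorial : ℂ)⁻¹) • (D ^ j) w ∈ S := by
  have : CompleteSpace E := FiniteDimensional.complete ℂ E
  have h1 : HasSum (fun n : ℕ => ((n.factorial : ℂ)⁻¹) • (D ^ n) w) (NormedSpace.exp D w) := by
    have := (NormedSpace.exp_series_hasSum_exp' (𝕂 := ℂ) D).mapL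
      (ContinuousLinearMap.apply ℂ E w)
    simpa using this
  have h2 := (hasSum_nat_add_iff' m).2 h1
  have h3 : ∀ j, (D ^ (j + m)) w ∈ S := by
    intro j
    induction j with
    | zero => simpa using hw
    | succ j ih => rw [add_right_comm, pow_succ']; exact hS _ ih
  refine S.closed_of_finiteDimensional.mem_of_tendsto h2 (.of_forall fun s => ?_)
  exact S.sum_mem fun j _ => S.smul_mem _ (h3 j)

end ExpSubmodule

/-! ### The eigenvalue filtration and its unipotent action -/

section Filtration

open Polynomial LieAlgebra

variable {𝔤 : Type*} [NormedLieRing 𝔤] [NormedLieAlgebra ℂ 𝔤] [FiniteDimensional ℂ 𝔤]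

/-- The sum of the eigenspaces of `ad x` to eigenvalues `μ` with `t ≤ l μ`. -/
def eigenFiltration (x : 𝔤) (l : ℂ →ₗ[ℝ] ℝ) (t : ℝ) : Submodule ℂ 𝔤 :=
  ⨆ (μ : ℂ) (_ : t ≤ l μ), (ad ℂ 𝔤 x).eigenspace μ

variable {x : 𝔤} {l : ℂ →ₗ[ℝ] ℝ} {s t : ℝ}

theorem mem_eigenspace_ad {μ : ℂ} {y : 𝔤} : y ∈ (ad ℂ 𝔤 x).eigenspace μ ↔ ⁅x, y⁆ = μ • y :=
  Module.End.mem_eigenspace_iff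

theorem eigenspace_le_eigenFiltration {μ : ℂ} (h : t ≤ l μ) :
    (ad ℂ 𝔤 x).eigenspace μ ≤ eigenFiltration x l t :=
  le_iSup₂_of_le μ h le_rfl

theorem eigenFiltration_le_iff {W : Submodule ℂ 𝔤} :
    eigenFiltration x l t ≤ W ↔ ∀ μ, t ≤ l μ → ∀ y, ⁅x, y⁆ = μ • y → y ∈ W := by
  rw [eigenFiltration, iSup₂_le_iff]
  simp only [SetLike.le_def, mem_eigenspace_ad]

theorem eigenFiltration_anti (h : s ≤ t) : eigenFiltration x l t ≤ eigenFiltration x l s :=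
  eigenFiltration_le_iff.2 fun _ hμ _ hy =>
    eigenspace_le_eigenFiltration (h.trans hμ) (mem_eigenspace_ad.2 hy)

/-- As `ad x` is a derivation, eigenvalues add under the bracket. -/
theorem lie_mem_eigenFiltration {y z : 𝔤} (hy : y ∈ eigenFiltration x l s)
    (hz : z ∈ eigenFiltration x l t) : ⁅y, z⁆ ∈ eigenFiltration x l (s + t) := by
  have h1 : ∀ μ, s ≤ l μ → ∀ y, ⁅x, y⁆ = μ • y → eigenFiltration x l t ≤
      (eigenFiltration x l (s + t)).comap (ad ℂ 𝔤 y) := by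
    intro μ hμ y hy
    refine eigenFiltration_le_iff.2 fun ν hν z hz => ?_
    refine eigenspace_le_eigenFiltration (μ := μ + ν) (by rw [map_add]; linarith) ?_
    rw [mem_eigenspace_ad, ad_apply, leibniz_lie, hy, hz, smul_lie, lie_smul, add_smul]
  have h2 : eigenFiltration x l s ≤
      (eigenFiltration x l (s + t)).comap ((ad ℂ 𝔤 : 𝔤 →ₗ[ℂ] Module.End ℂ 𝔤).flip z) :=
    eigenFiltration_le_iff.2 fun μ hμ y hy => h1 μ hμ y hy hz
  exact h2 hy

/-- Positivity of `t` excludes the eigenvalue `0`, so `ad x` can be inverted on each eigenspace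
involved. -/
theorem exists_lie_eq_of_mem_eigenFiltration (ht : 0 < t) {y : 𝔤}
    (hy : y ∈ eigenFiltration x l t) : ∃ z ∈ eigenFiltration x l t, ⁅x, z⁆ = y := by
  have h : eigenFiltration x l t ≤ (eigenFiltration x l t).map (ad ℂ 𝔤 x) := by
    refine eigenFiltration_le_iff.2 fun μ hμ y hy => ?_
    have hμ0 : μ ≠ 0 := by
      rintro rfl
      rw [map_zero] at hμ
      exact absurd hμ (not_le.2 ht)
    refine ⟨μ⁻¹ • y, Submodule.smul_mem _ _ (eigenspace_le_eigenFiltration hμ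
      (mem_eigenspace_ad.2 hy)), ?_⟩
    rw [map_smul, ad_apply, hy, smul_smul, inv_mul_cancel₀ hμ0, one_smul]
  exact h hy

theorem iSup_eigenspace_ad {p : ℂ[X]} (hp : Squarefree p) (hx : x ∈ adVariety p) :
    ⨆ μ, (ad ℂ 𝔤 x).eigenspace μ = ⊤ := by
  rw [← Module.End.iSup_maxGenEigenspace_eq_top (ad ℂ 𝔤 x)]
  refine iSup_congr fun μ => ?_
  rw [Module.End.maxGenEigenspace,
    (isSemisimple_ad_of_mem_adVariety hp hx).isFinitelySemisimple.genEigenspace_eq_eigenspace μ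
      (by simp)]

theorem eigenFiltration_eq_bot {p : ℂ[X]} (hx : x ∈ adVariety p) (h : ∀ μ, p.eval μ = 0 → l μ < t) :
    eigenFiltration x l t = ⊥ := by
  rw [eq_bot_iff]
  refine eigenFiltration_le_iff.2 fun μ hμ y hy => ?_
  by_contra hy0
  exact absurd (h μ (eval_eq_zero_of_mem_adVariety hx hy0 hy)) (not_lt.2 hμ)

/-- An automorphism fixing `x` commutes with `ad x`, hence preserves its eigenspaces. -/
theorem apply_mem_eigenFiltration {u : (𝔤 →L[ℂ] 𝔤)ˣ} (hu : u ∈ adjointGroup 𝔤)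
    (hux : (u : 𝔤 →L[ℂ] 𝔤) x = x) {y : 𝔤} (hy : y ∈ eigenFiltration x l t) :
    (u : 𝔤 →L[ℂ] 𝔤) y ∈ eigenFiltration x l t := by
  have h : eigenFiltration x l t ≤ (eigenFiltration x l t).comap ((u : 𝔤 →L[ℂ] 𝔤) : 𝔤 →ₗ[ℂ] 𝔤) := by
    refine eigenFiltration_le_iff.2 fun μ hμ y hy => ?_
    refine eigenspace_le_eigenFiltration hμ (mem_eigenspace_ad.2 ?_)
    have := adjointGroup_lie hu x y
    rw [hux, hy, map_smul] at this
    exact this.symm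
  exact h hy

theorem inv_apply_mem_of_forall_apply_mem {u : (𝔤 →L[ℂ] 𝔤)ˣ} {N : Submodule ℂ 𝔤}
    (h : ∀ y ∈ N, (u : 𝔤 →L[ℂ] 𝔤) y ∈ N) {y : 𝔤} (hy : y ∈ N) :
    (↑u⁻¹ : 𝔤 →L[ℂ] 𝔤) y ∈ N := by
  set e := (ContinuousLinearEquiv.unitsEquiv ℂ 𝔤 u).toLinearEquiv
  have h1 : N.map (e : 𝔤 →ₗ[ℂ] 𝔤) = N := by
    refine Submodule.eq_of_le_of_finrank_eq ?_ (LinearEquiv.finrank_map_eq e N)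
    rintro _ ⟨z, hz, rfl⟩
    exact h z hz
  rw [← h1] at hy
  obtain ⟨z, hz, rfl⟩ := hy
  have : (↑u⁻¹ : 𝔤 →L[ℂ] 𝔤) ((u : 𝔤 →L[ℂ] 𝔤) z) ∈ N := by rwa [units_inv_apply_apply]
  exact this

/-- The unipotent group of `eigenFiltration x l δ` acts transitively on the leaf through `x`. -/
theorem exists_apply_eq_add {p : ℂ[X]} (hp : p ≠ 0) (hx : x ∈ adVariety p) {δ : ℝ} (hδ : 0 < δ)
    {y : 𝔤} (hy : y ∈ eigenFiltration x l δ) :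
    ∃ u ∈ adjointGroup 𝔤, (u : 𝔤 →L[ℂ] 𝔤) x = x + y ∧
      ∀ z ∈ eigenFiltration x l δ, (u : 𝔤 →L[ℂ] 𝔤) z ∈ eigenFiltration x l δ := by
  -- Successive approximation, starting from `u = 1` and error `r = -y`. If `⁅x, z⁆ = r`, then `exp
  -- (ad z)` cancels the error `r` to first order and leaves one a filtration step deeper.
  have hstep : ∀ k : ℕ, ∃ u ∈ adjointGroup 𝔤, ∃ r ∈ eigenFiltration x l ((k + 1 : ℕ) * δ),
      (u : 𝔤 →L[ℂ] 𝔤) x = x + y + r ∧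
      ∀ z ∈ eigenFiltration x l δ, (u : 𝔤 →L[ℂ] 𝔤) z ∈ eigenFiltration x l δ := by
    intro k
    induction k with
    | zero => exact ⟨1, one_mem _, -y, Submodule.neg_mem _ (by simpa using hy), by simp, by simp⟩
    | succ k ih =>
      obtain ⟨u, hu, r, hr, hur, huN⟩ := ih
      have hk : 0 < ((k + 1 : ℕ) : ℝ) * δ := by positivity
      have hkδ : δ ≤ ((k + 1 : ℕ) : ℝ) * δ := by push_cast; nlinarith [k.cast_nonneg (α := ℝ)]
      obtain ⟨z, hz, hzr⟩ := exists_lie_eq_of_mem_eigenFiltration hk hr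
      obtain ⟨v, hv, hvz⟩ := exists_mem_adjointGroup z
      have hzN : ∀ t, ∀ w ∈ eigenFiltration x l t, adL z w ∈ eigenFiltration x l t := fun t w hw =>
        eigenFiltration_anti (by linarith) (lie_mem_eigenFiltration hz hw)
      have hrN : r ∈ eigenFiltration x l δ := eigenFiltration_anti hkδ hr
      have hz' : ∀ w ∈ eigenFiltration x l δ,
          adL z w ∈ eigenFiltration x l ((k + 1 + 1 : ℕ) * δ) := fun w hw =>
        eigenFiltration_anti (by push_cast; linarith) (lie_mem_eigenFiltration hz hw)
      have hzx : adL z x = -r := by rw [adL_apply, ← lie_skew, hzr]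
      -- Since `ad z` sends `x` to `-r`, and sends `y` and `r` into the next step, two terms of the
      -- series are kept on `x` and one on `y + r`.
      have e1 := exp_apply_sub_mem (D := adL z) (m := 2) (w := x) (hzN ((k + 1 + 1 : ℕ) * δ))
        (by rw [pow_two, mul_apply_eq_comp, hzx]; exact hz' _ (Submodule.neg_mem _ hrN))
      have e2 := exp_apply_sub_mem (D := adL z) (m := 1) (w := y + r)
        (hzN ((k + 1 + 1 : ℕ) * δ)) (by rw [pow_one]; exact hz' _ (Submodule.add_mem _ hy hrN))
      refine ⟨v * u, mul_mem hv hu, _, Submodule.add_mem _ e1 e2, ?_, fun w hw => ?_⟩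
      · rw [Units.val_mul, mul_apply_eq_comp, hur, hvz, add_assoc, map_add]
        simp only [Finset.sum_range_succ, Finset.sum_range_zero, pow_zero, pow_one, hzx,
          one_apply_eq_self, Nat.factorial_zero, Nat.factorial_one, Nat.cast_one, inv_one, one_smul]
        abel
      · rw [Units.val_mul, mul_apply_eq_comp, hvz]
        have e3 := exp_apply_sub_mem (D := adL z) (m := 0) (hzN δ) (huN w hw)
        simpa using e3
  -- Beyond the largest value of `l` on the roots the filtration vanishes, and so does the error.
  have hfin : {a | p.IsRoot a}.Finite := p.finite_setOfPred_isRoot hp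
  obtain ⟨C, hC⟩ := (hfin.image l).bddAbove
  obtain ⟨k, hk⟩ := exists_nat_gt (C / δ)
  obtain ⟨u, hu, r, hr, hur, huN⟩ := hstep k
  rw [eigenFiltration_eq_bot hx fun μ hμ => ?_, Submodule.mem_bot] at hr
  · exact ⟨u, hu, by rw [hur, hr, add_zero], huN⟩
  · have h1 : l μ ≤ C := hC ⟨μ, hμ, rfl⟩
    rw [div_lt_iff₀ hδ] at hk
    push_cast
    linarith

/-- A real linear functional on `ℂ` which is bounded away from zero on the nonzero roots. -/
theorem exists_linear_functional {p : ℂ[X]} (hp : p ≠ 0) :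
    ∃ (l : ℂ →ₗ[ℝ] ℝ) (δ : ℝ), 0 < δ ∧ ∀ μ, p.eval μ = 0 → μ ≠ 0 → δ ≤ |l μ| := by
  have hfin : {a | p.IsRoot a}.Finite := p.finite_setOfPred_isRoot hp
  -- A nonreal root is annihilated by `Re + t Im` for exactly one `t`, a nonzero real root for none.
  obtain ⟨t, ht⟩ := ((hfin.image fun z : ℂ => -z.re / z.im)).exists_notMem
  obtain ⟨t, ht, ht0⟩ : ∃ t : ℝ, t ∉ (fun z : ℂ => -z.re / z.im) '' {a | p.IsRoot a} ∧
      ∀ a, p.IsRoot a → a ≠ 0 → a.re + t * a.im ≠ 0 := by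
    refine ⟨t, ht, fun a ha ha0 h => ?_⟩
    by_cases him : a.im = 0
    · rw [him, mul_zero, add_zero] at h
      exact ha0 (Complex.ext h him)
    · refine ht ⟨a, ha, ?_⟩
      simp only
      rw [div_eq_iff him]
      linarith
  set l : ℂ →ₗ[ℝ] ℝ := Complex.reLm + t • Complex.imLm with hl
  have hlz : ∀ a, l a = a.re + t * a.im := fun a => by simp [hl]
  have hf2 : ((fun a => |l a|) '' {a | p.IsRoot a ∧ a ≠ 0}).Finite :=
    (hfin.subset fun a ha => ha.1).image _
  have hn : ((fun a => |l a|) '' {a | p.IsRoot a ∧ a ≠ 0})ᶜ ∈ 𝓝 (0 : ℝ) := by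
    refine hf2.isClosed.isOpen_compl.mem_nhds ?_
    rintro ⟨a, ⟨ha, ha0⟩, h⟩
    exact ht0 a ha ha0 (by rw [← hlz]; exact abs_eq_zero.1 h)
  obtain ⟨δ, hδ, hball⟩ := Metric.mem_nhds_iff.1 hn
  refine ⟨l, δ, hδ, fun μ hμ hμ0 => ?_⟩
  by_contra! hlt
  exact hball (by simpa using hlt) ⟨μ, ⟨hμ, hμ0⟩, rfl⟩

theorem killingForm_eq_zero_of_mem_eigenspace {μ ν : ℂ} (h : μ + ν ≠ 0) {y z : 𝔤}
    (hy : ⁅x, y⁆ = μ • y) (hz : ⁅x, z⁆ = ν • z) : killingForm ℂ 𝔤 y z = 0 := by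
  have h1 : killingForm ℂ 𝔤 ⁅y, x⁆ z = killingForm ℂ 𝔤 y ⁅x, z⁆ := killingForm_lie y x z
  rw [← lie_skew, hy, hz] at h1
  simp only [map_neg, map_smul, LinearMap.neg_apply, LinearMap.smul_apply, smul_eq_mul] at h1
  have h2 : (μ + ν) * killingForm ℂ 𝔤 y z = 0 := by linear_combination -h1
  exact (mul_eq_zero.1 h2).resolve_left h

variable [LieAlgebra.IsSemisimple ℂ 𝔤]

/-- The eigenspaces for `μ` and `ν` are Killing-orthogonal unless `μ + ν = 0`. So an eigenspace not
contributing to `Q` is orthogonal to `P`, and nondegeneracy embeds `P` into the dual of `Q`. -/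
theorem finrank_eigenFiltration_le {p : ℂ[X]} (hp : Squarefree p) (hx : x ∈ adVariety p)
    (δ : ℝ) : Module.finrank ℂ (eigenFiltration x l δ) ≤
      Module.finrank ℂ (eigenFiltration x (-l) δ) := by
  set P := eigenFiltration x l δ with hP
  set Q := eigenFiltration x (-l) δ with hQ
  rw [← Subspace.dual_finrank_eq (V := Q)]
  refine LinearMap.finrank_le_finrank_of_injective
    (f := ((killingForm ℂ 𝔤).domRestrict₁₂ P Q)) ?_
  rw [injective_iff_map_eq_zero]
  intro y hy
  refine Subtype.ext (eq_zero_of_forall_killingForm fun z => ?_)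
  have hz : z ∈ ⨆ μ, (ad ℂ 𝔤 x).eigenspace μ := by
    rw [iSup_eigenspace_ad hp hx]; exact Submodule.mem_top
  have hle : ⨆ μ, (ad ℂ 𝔤 x).eigenspace μ ≤ (killingForm ℂ 𝔤 y).ker := by
    refine iSup_le fun ν z hz => ?_
    rw [LinearMap.mem_ker]
    rw [mem_eigenspace_ad] at hz
    by_cases hν : δ ≤ (-l) ν
    · exact LinearMap.congr_fun hy
        ⟨z, eigenspace_le_eigenFiltration hν (mem_eigenspace_ad.2 hz)⟩
    · have hPle : P ≤ (killingForm ℂ 𝔤 z).ker := by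
        refine eigenFiltration_le_iff.2 fun μ hμ w hw => ?_
        rw [LinearMap.mem_ker, killingForm_symm]
        refine killingForm_eq_zero_of_mem_eigenspace (fun h => ?_) hw hz
        have h1 : l μ + l ν = 0 := by rw [← map_add, h, map_zero]
        rw [LinearMap.neg_apply] at hν
        linarith
      exact (killingForm_symm _ _).trans (hPle y.2)
  exact hle hz

/-- The range of the semisimple `ad x` is the sum of its eigenspaces for nonzero eigenvalues. The
sign of `l` splits it into two parts, of equal dimension by duality. -/
theorem two_mul_finrank_eigenFiltration {p : ℂ[X]} (hp : Squarefree p) (hx : x ∈ adVariety p)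
    {δ : ℝ} (hδ : 0 < δ) (h : ∀ μ, p.eval μ = 0 → μ ≠ 0 → δ ≤ |l μ|) :
    Module.finrank ℂ (adL x).range = 2 * Module.finrank ℂ (eigenFiltration x l δ) := by
  have heq : Module.finrank ℂ (eigenFiltration x l δ) =
      Module.finrank ℂ (eigenFiltration x (-l) δ) := by
    refine le_antisymm (finrank_eigenFiltration_le hp hx δ) ?_
    have := finrank_eigenFiltration_le (l := -l) hp hx δ
    rwa [neg_neg] at this
  have hsup : (adL x).range = eigenFiltration x l δ ⊔ eigenFiltration x (-l) δ := by
    apply le_antisymm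
    · rintro _ ⟨z, rfl⟩
      have hz : z ∈ ⨆ μ, (ad ℂ 𝔤 x).eigenspace μ := by
        rw [iSup_eigenspace_ad hp hx]; exact Submodule.mem_top
      have hle : ⨆ μ, (ad ℂ 𝔤 x).eigenspace μ ≤
          (eigenFiltration x l δ ⊔ eigenFiltration x (-l) δ).comap (ad ℂ 𝔤 x) := by
        refine iSup_le fun μ y hy => ?_
        have hy' := mem_eigenspace_ad.1 hy
        rw [Submodule.mem_comap, ad_apply, hy']
        by_cases hy0 : y = 0
        · simp [hy0]
        by_cases hμ0 : μ = 0
        · simp [hμ0]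
        refine Submodule.smul_mem _ _ ?_
        rcases le_abs.1 (h μ (eval_eq_zero_of_mem_adVariety hx hy0 hy') hμ0) with h1 | h1
        · exact Submodule.mem_sup_left (eigenspace_le_eigenFiltration h1 hy)
        · exact Submodule.mem_sup_right (eigenspace_le_eigenFiltration (l := -l) h1 hy)
      exact hle hz
    · refine sup_le (fun y hy => ?_) (fun y hy => ?_)
      · obtain ⟨z, -, hz⟩ := exists_lie_eq_of_mem_eigenFiltration hδ hy
        exact ⟨z, hz⟩
      · obtain ⟨z, -, hz⟩ := exists_lie_eq_of_mem_eigenFiltration hδ hy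
        exact ⟨z, hz⟩
  have hdisj : Disjoint (eigenFiltration x l δ) (eigenFiltration x (-l) δ) := by
    refine iSupIndep.disjoint_biSup_biSup (ad ℂ 𝔤 x).eigenspaces_iSupIndep
      (s := {μ | δ ≤ l μ}) (t := {μ | δ ≤ (-l) μ}) ?_
    rw [Set.disjoint_left]
    intro μ h1 h2
    simp only [mem_ofPred_eq, LinearMap.neg_apply] at h1 h2
    linarith
  have := Submodule.finrank_sup_add_finrank_inf_eq (eigenFiltration x l δ)
    (eigenFiltration x (-l) δ)
  rw [hdisj.eq_bot, finrank_bot, add_zero, ← hsup, ← heq] at this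
  rw [this, two_mul]

end Filtration

/-! ### Partition of the orbit into affine leaves -/

section Leaves

open Polynomial

variable {𝔤 : Type*} [NormedLieRing 𝔤] [NormedLieAlgebra ℂ 𝔤] [FiniteDimensional ℂ 𝔤]
  {x : 𝔤} {l : ℂ →ₗ[ℝ] ℝ} {δ : ℝ}

/-- The image of a subspace under an invertible operator. -/
abbrev unitsMap (u : (𝔤 →L[ℂ] 𝔤)ˣ) (N : Submodule ℂ 𝔤) : Submodule ℂ 𝔤 :=
  N.map ((u : 𝔤 →L[ℂ] 𝔤) : 𝔤 →ₗ[ℂ] 𝔤)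

theorem finrank_unitsMap (u : (𝔤 →L[ℂ] 𝔤)ˣ) (N : Submodule ℂ 𝔤) :
    Module.finrank ℂ (unitsMap u N) = Module.finrank ℂ N :=
  LinearEquiv.finrank_map_eq (ContinuousLinearEquiv.unitsEquiv ℂ 𝔤 u).toLinearEquiv N

/-- Translates of the leaf `x + eigenFiltration x l δ` which meet have the same direction. -/
theorem unitsMap_eigenFiltration_le {p : ℂ[X]} (hp : p ≠ 0) (hx : x ∈ adVariety p)
    (hδ : 0 < δ) {g g' : (𝔤 →L[ℂ] 𝔤)ˣ} (hg : g ∈ adjointGroup 𝔤) (hg' : g' ∈ adjointGroup 𝔤)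
    {y y' : 𝔤} (hy : y ∈ eigenFiltration x l δ) (hy' : y' ∈ eigenFiltration x l δ)
    (h : (g : 𝔤 →L[ℂ] 𝔤) (x + y) = (g' : 𝔤 →L[ℂ] 𝔤) (x + y')) :
    unitsMap g (eigenFiltration x l δ) ≤ unitsMap g' (eigenFiltration x l δ) := by
  obtain ⟨u, hu, hux, huN⟩ := exists_apply_eq_add hp hx hδ hy
  obtain ⟨u', hu', hux', huN'⟩ := exists_apply_eq_add hp hx hδ hy'
  -- Both `g u` and `g' u'` carry `x` to the common point, so `k` fixes `x` and preserves the
  -- filtration `N`. The claim follows from `g N = g u N = g' u' k N`.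
  set k : (𝔤 →L[ℂ] 𝔤)ˣ := (g' * u')⁻¹ * (g * u) with hk
  have hkG : k ∈ adjointGroup 𝔤 := mul_mem (inv_mem (mul_mem hg' hu')) (mul_mem hg hu)
  have hkx : (k : 𝔤 →L[ℂ] 𝔤) x = x := by
    have e1 : ((g * u : (𝔤 →L[ℂ] 𝔤)ˣ) : 𝔤 →L[ℂ] 𝔤) x =
        ((g' * u' : (𝔤 →L[ℂ] 𝔤)ˣ) : 𝔤 →L[ℂ] 𝔤) x := by
      rw [Units.val_mul, Units.val_mul, mul_apply_eq_comp, mul_apply_eq_comp, hux, hux', h]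
    rw [hk, Units.val_mul, mul_apply_eq_comp, e1, units_inv_apply_apply]
  have hgk : g * u = g' * u' * k := by rw [hk]; group
  rintro _ ⟨v, hv, rfl⟩
  set w := (↑u⁻¹ : 𝔤 →L[ℂ] 𝔤) v with hw
  have hwN : w ∈ eigenFiltration x l δ := inv_apply_mem_of_forall_apply_mem huN hv
  refine ⟨(u' : 𝔤 →L[ℂ] 𝔤) ((k : 𝔤 →L[ℂ] 𝔤) w),
    huN' _ (apply_mem_eigenFiltration hkG hkx hwN), ?_⟩
  have e2 : (g : 𝔤 →L[ℂ] 𝔤) v = ((g * u : (𝔤 →L[ℂ] 𝔤)ˣ) : 𝔤 →L[ℂ] 𝔤) w := by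
    rw [Units.val_mul, mul_apply_eq_comp, hw, units_apply_inv_apply]
  change (g' : 𝔤 →L[ℂ] 𝔤) _ = (g : 𝔤 →L[ℂ] 𝔤) v
  rw [e2, hgk, Units.val_mul (g' * u') k, Units.val_mul g' u', mul_apply_eq_comp, mul_apply_eq_comp]

/-- Every fibre of the height function is a disjoint union of affine subspaces. -/
theorem exists_affine_decomposition_fibre {p : ℂ[X]} (hp : p ≠ 0)
    (hx : x ∈ adVariety p) (hδ : 0 < δ) (H : 𝔤) (c : ℂ) :
    ∃ S : Set (AffineSubspace ℂ 𝔤),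
      fibre (adjointOrbit x) (heightFunction H) c = ⋃ A ∈ S, (A : Set 𝔤) ∧
      S.PairwiseDisjoint (fun A => (A : Set 𝔤)) ∧
      ∀ A ∈ S, (A : Set 𝔤).Nonempty ∧
        (Module.finrank ℂ A.direction = Module.finrank ℂ (eigenFiltration x l δ) ∨
          Module.finrank ℂ A.direction + 1 = Module.finrank ℂ (eigenFiltration x l δ)) ∧
        (A : Set 𝔤) ⊆ adjointOrbit x := by
  set N := eigenFiltration x l δ with hN
  set K := (heightL H : 𝔤 →ₗ[ℂ] ℂ).ker with hK
  have hKsub : ∀ {y z : 𝔤}, y - z ∈ K ↔ heightFunction H y = heightFunction H z := by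
    intro y z
    rw [hK, LinearMap.mem_ker, map_sub, sub_eq_zero]
    rfl
  have hleaf : ∀ g ∈ adjointGroup 𝔤, ∀ y ∈ N, (g : 𝔤 →L[ℂ] 𝔤) (x + y) ∈ adjointOrbit x := by
    intro g hg y hy
    obtain ⟨u, hu, hux, -⟩ := exists_apply_eq_add hp hx hδ hy
    rw [← hux]
    exact ⟨g * u, mul_mem hg hu, rfl⟩
  have hmem : ∀ (g : (𝔤 →L[ℂ] 𝔤)ˣ), ∀ y ∈ N, ∀ z : 𝔤,
      z - (g : 𝔤 →L[ℂ] 𝔤) (x + y) ∈ unitsMap g N → ∃ y' ∈ N, z = (g : 𝔤 →L[ℂ] 𝔤) (x + y') := by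
    rintro g y hy z ⟨v, hv, hvz⟩
    refine ⟨y + v, N.add_mem hy hv, ?_⟩
    have hvz' : (g : 𝔤 →L[ℂ] 𝔤) v = z - (g : 𝔤 →L[ℂ] 𝔤) (x + y) := hvz
    rw [← add_assoc, map_add, hvz', add_sub_cancel]
  -- Many pairs `(g, y)` give the same piece; collecting the pieces in a set identifies these.
  refine ⟨{A | ∃ g ∈ adjointGroup 𝔤, ∃ y ∈ N,
    heightFunction H ((g : 𝔤 →L[ℂ] 𝔤) (x + y)) = c ∧
      A = AffineSubspace.mk' ((g : 𝔤 →L[ℂ] 𝔤) (x + y)) (unitsMap g N ⊓ K)}, ?_, ?_, ?_⟩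
  · ext z
    simp only [mem_iUnion, exists_prop, SetLike.mem_coe]
    constructor
    · rintro ⟨⟨g, hg, rfl⟩, hz⟩
      refine ⟨_, ⟨g, hg, 0, N.zero_mem, by rwa [add_zero], rfl⟩, ?_⟩
      rw [add_zero]
      exact AffineSubspace.self_mem_mk' _ _
    · rintro ⟨_, ⟨g, hg, y, hy, hc, rfl⟩, hz⟩
      rw [AffineSubspace.mem_mk', vsub_eq_sub, Submodule.mem_inf, hKsub, hc] at hz
      obtain ⟨y', hy', rfl⟩ := hmem g y hy z hz.1
      exact ⟨hleaf g hg y' hy', hz.2⟩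
  · rintro _ ⟨g, hg, y, hy, hc, rfl⟩ _ ⟨g', hg', y', hy', hc', rfl⟩ hne
    rw [Function.onFun, Set.disjoint_left]
    intro z hz hz'
    refine hne ?_
    rw [SetLike.mem_coe] at hz hz'
    have hz1 := hz
    have hz1' := hz'
    rw [AffineSubspace.mem_mk', vsub_eq_sub, Submodule.mem_inf] at hz1 hz1'
    obtain ⟨w, hw, hzw⟩ := hmem g y hy z hz1.1
    obtain ⟨w', hw', hzw'⟩ := hmem g' y' hy' z hz1'.1
    have hgg : unitsMap g N = unitsMap g' N := le_antisymm
      (unitsMap_eigenFiltration_le hp hx hδ hg hg' hw hw' (hzw.symm.trans hzw'))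
      (unitsMap_eigenFiltration_le hp hx hδ hg' hg hw' hw (hzw'.symm.trans hzw))
    refine AffineSubspace.ext_of_direction_eq ?_ ⟨z, hz, hz'⟩
    rw [AffineSubspace.direction_mk', AffineSubspace.direction_mk', hgg]
  · rintro _ ⟨g, hg, y, hy, hc, rfl⟩
    refine ⟨⟨_, AffineSubspace.self_mem_mk' _ _⟩, ?_, fun z hz => ?_⟩
    · rw [AffineSubspace.direction_mk', ← finrank_unitsMap g N]
      by_cases hle : ∃ e ∈ unitsMap g N, heightL H e ≠ 0
      · exact .inr (finrank_inf_ker_add_one hle)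
      · push Not at hle
        left
        rw [inf_eq_left.2 fun e he => hle e he]
    · rw [SetLike.mem_coe, AffineSubspace.mem_mk', vsub_eq_sub, Submodule.mem_inf] at hz
      obtain ⟨y', hy', rfl⟩ := hmem g y hy z hz.1
      exact hleaf g hg y' hy'

end Leaves

/-! ### A uniform implicit function theorem -/

section SmallSolutions

open Filter Metric
open scoped NNReal

variable {X Z : Type*} [NormedAddCommGroup X] [NormedSpace ℝ X] [CompleteSpace X]
  [NormedAddCommGroup Z] [NormedSpace ℝ Z] [FiniteDimensional ℝ Z]

/-- The lower bound gives injectivity, which suffices for an endomorphism in finite dimension. -/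
theorem exists_continuousLinearEquiv_of_le {L : Z →L[ℝ] Z} {N : ℝ}
    (h : ∀ z, ‖z‖ ≤ N * ‖L z‖) : ∃ e : Z ≃L[ℝ] Z, (e : Z →L[ℝ] Z) = L := by
  have hinj : Function.Injective (L : Z →ₗ[ℝ] Z) :=
    (injective_iff_map_eq_zero _).2 fun z hz => by
      have h1 := h z
      rw [show L z = 0 from hz, norm_zero, mul_zero] at h1
      exact norm_le_zero_iff.1 h1
  refine ⟨(LinearEquiv.ofInjectiveEndo (L : Z →ₗ[ℝ] Z) hinj).toContinuousLinearEquiv, ?_⟩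
  ext z
  rfl

/-- Uniform inverse function theorem with parameters: if `G (x, ·)` is uniformly close to a
uniformly invertible linear map, the equation `G (x, z) = 0` has a unique small solution, which
depends smoothly on `x`. -/
theorem exists_small_solution {G : X × Z → Z} (hG : ContDiff ℝ ω G) {A : Set X}
    {L : X → Z →L[ℝ] Z} {N η ε : ℝ} (hN : 0 < N) (hη : 0 ≤ η) (hNη : N * η ≤ 1 / 2)
    (hL : ∀ x ∈ A, ∀ z, ‖z‖ ≤ N * ‖L x z‖)
    (happ : ∀ x ∈ A, ∀ z z', ‖z‖ < ε → ‖z'‖ < ε →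
      ‖G (x, z) - G (x, z') - L x (z - z')‖ ≤ η * ‖z - z'‖)
    (h0 : ∀ x ∈ A, 2 * N * ‖G (x, 0)‖ < ε) :
    ∃ u : X → Z, ∀ x ∈ A, ‖u x‖ ≤ 2 * N * ‖G (x, 0)‖ ∧ G (x, u x) = 0 ∧
      (∀ z, ‖z‖ < ε → G (x, z) = 0 → z = u x) ∧
      ∃ σ : X → Z, ContDiffAt ℝ ω σ x ∧ ∀ᶠ y in 𝓝 x, y ∈ A → u y = σ y := by
  have : CompleteSpace Z := FiniteDimensional.complete ℝ Z
  have hex : ∀ x, ∃ z, x ∈ A → ‖z‖ ≤ 2 * N * ‖G (x, 0)‖ ∧ G (x, z) = 0 := by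
    intro x
    by_cases hx : x ∈ A
    swap
    · exact ⟨0, fun h => absurd h hx⟩
    obtain ⟨e, he⟩ := exists_continuousLinearEquiv_of_le (hL x hx)
    have hsymm : ‖(e.symm : Z →L[ℝ] Z)‖ ≤ N := by
      refine ContinuousLinearMap.opNorm_le_bound _ hN.le fun z => ?_
      have h1 := hL x hx (e.symm z)
      rw [← he] at h1
      simpa using h1
    let R : (e : Z →L[ℝ] Z).NonlinearRightInverse :=
      { toFun := e.symm
        nnnorm := ⟨N, hN.le⟩
        bound' := fun z => (e.symm : Z →L[ℝ] Z).le_of_opNorm_le hsymm z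
        right_inv' := e.apply_symm_apply }
    have hA : ApproximatesLinearOn (fun z => G (x, z)) (e : Z →L[ℝ] Z) (ball 0 ε) ⟨η, hη⟩ := by
      intro z hz z' hz'
      rw [he]
      exact happ x hx z z' (by simpa using hz) (by simpa using hz')
    -- With `N η ≤ 1 / 2`, the image of the ball of radius `ρ` covers a ball of radius `(N⁻¹ - η) ρ
    -- ≥ ‖G (x, 0)‖` about `G (x, 0)`, hence contains `0`.
    set ρ := 2 * N * ‖G (x, 0)‖ with hρ
    have hρ0 : 0 ≤ ρ := by positivity
    have hs := hA.surjOn_closedBall_of_nonlinearRightInverse R hρ0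
      (closedBall_subset_ball (h0 x hx))
    have hmem : (0 : Z) ∈ closedBall (G (x, 0)) (((R.nnnorm : ℝ)⁻¹ - η) * ρ) := by
      rw [mem_closedBall, dist_eq_norm, zero_sub, norm_neg]
      have h3 : (N⁻¹ - η) * ρ = (2 - 2 * (N * η)) * ‖G (x, 0)‖ := by
        rw [hρ]; field_simp
      change ‖G (x, 0)‖ ≤ (N⁻¹ - η) * ρ
      rw [h3]
      nlinarith [norm_nonneg (G (x, 0))]
    obtain ⟨z, hz, hz'⟩ := hs hmem
    exact ⟨z, fun _ => ⟨by simpa using hz, hz'⟩⟩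
  choose u hu using hex
  have huniq : ∀ x ∈ A, ∀ z, ‖z‖ < ε → G (x, z) = 0 → z = u x := by
    intro x hx z hz hGz
    have h1 := happ x hx z (u x) hz ((hu x hx).1.trans_lt (h0 x hx))
    rw [hGz, (hu x hx).2, sub_zero, zero_sub, norm_neg] at h1
    have h2 := hL x hx (z - u x)
    have h3 : ‖z - u x‖ ≤ 1 / 2 * ‖z - u x‖ := by
      calc _ ≤ N * ‖L x (z - u x)‖ := h2
        _ ≤ N * (η * ‖z - u x‖) := by gcongr
        _ = (N * η) * ‖z - u x‖ := by ring
        _ ≤ _ := by gcongr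
    have h4 : ‖z - u x‖ ≤ 0 := by linarith
    exact sub_eq_zero.1 (norm_le_zero_iff.1 h4)
  refine ⟨u, fun x hx => ⟨(hu x hx).1, (hu x hx).2, huniq x hx, ?_⟩⟩
  have hux : ‖u x‖ < ε := (hu x hx).1.trans_lt (h0 x hx)
  refine exists_contDiffAt_of_unique_solution (F := G) (B := ball 0 ε) hG.contDiffAt ?_ isOpen_ball
    (by simpa using hux) fun y hy z hz hGz =>
      huniq y hy z (by simpa using hz) (by rw [hGz, (hu x hx).2])
  set D := fderiv ℝ G (x, u x) ∘L .inr ℝ X Z with hD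
  have hGd : HasFDerivAt G (fderiv ℝ G (x, u x)) (x, u x) :=
    (hG.differentiable (by simp)).differentiableAt.hasFDerivAt
  have hd : HasFDerivAt (fun z => G (x, z)) D (u x) :=
    hGd.comp (u x) (hasFDerivAt_prodMk_right x (u x))
  -- The partial derivative at the solution is within `η` of `L x`, hence still invertible, with
  -- constant `2 N`.
  have hle : ‖D - L x‖ ≤ η := by
    refine (hd.sub (L x).hasFDerivAt).le_of_lip' hη ?_
    filter_upwards [isOpen_ball.mem_nhds (show u x ∈ ball 0 ε by simpa using hux)] with z hz
    have := happ x hx z (u x) (by simpa using hz) hux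
    rw [map_sub] at this
    convert this using 2
    simp only [Pi.sub_apply]
    abel
  have hDL : ∀ z, ‖z‖ ≤ 2 * N * ‖D z‖ := fun z => by
    have h1 : ‖(D - L x) z‖ ≤ η * ‖z‖ := (D - L x).le_of_opNorm_le hle z
    have h2 : ‖L x z‖ ≤ ‖D z‖ + ‖(D - L x) z‖ := by
      have : L x z = D z - (D - L x) z := by simp
      rw [this]
      exact norm_sub_le _ _
    have h3 : ‖z‖ ≤ N * ‖D z‖ + 1 / 2 * ‖z‖ := by
      calc _ ≤ N * ‖L x z‖ := hL x hx z
        _ ≤ N * (‖D z‖ + η * ‖z‖) := by gcongr; linarith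
        _ = N * ‖D z‖ + (N * η) * ‖z‖ := by ring
        _ ≤ _ := by gcongr
    linarith
  obtain ⟨e, he⟩ := exists_continuousLinearEquiv_of_le hDL
  exact ⟨e, he⟩

end SmallSolutions

/-! ### Matching nearby fibres -/

section ShiftFibres

open Filter Metric

variable {E : Type*} [NormedAddCommGroup E] [NormedSpace ℂ E] [FiniteDimensional ℂ E]

/-- Nearby fibres of `f|_M` are diffeomorphic if `M` is preserved by a family of maps moving
uniformly across the fibres. -/
theorem eventually_areDiffeomorphic_fibre {M : Set E} {f : E →L[ℂ] ℂ} {P : ℂ × E → E} {W : E → E}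
    (hP : ContDiff ℝ ω P) (hM : ∀ s x, P (s, x) ∈ M ↔ x ∈ M)
    (h0 : ∀ x, P (0, x) = x) {C K δ r : ℝ} (hδ : 0 < δ) (hr : 0 < r) {c₀ : ℂ}
    (hest : ∀ η > 0, ∃ ε > 0, ∀ s s' x x', ‖s‖ < ε → ‖s'‖ < ε →
      ‖P (s, x) - P (s', x') - (x - x') - (s - s') • W x'‖ ≤ η * (‖x - x'‖ + ‖s - s'‖))
    (hWC : ∀ x, ‖W x‖ ≤ C) (hWK : ∀ x x', ‖W x - W x'‖ ≤ K * ‖x - x'‖)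
    (hW : ∀ x ∈ M, ‖f x - c₀‖ ≤ r → δ ≤ ‖f (W x)‖) :
    ∀ᶠ c in 𝓝 c₀, AreDiffeomorphic (fibre M f c₀) (fibre M f c) := by
  have : FiniteDimensional ℝ E := FiniteDimensional.complexToReal E
  have : CompleteSpace E := FiniteDimensional.complete ℝ E
  have hC : 0 ≤ C := (norm_nonneg _).trans (hWC 0)
  -- `N₁` bounds the inverse of `s ↦ s f (W x)`, and `N₂` that of `(v, s) ↦ (v + s W y, f v)`; `η₁`
  -- and `η₂` are the admissible errors.
  set N₁ := δ⁻¹ with hN₁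
  set N₂ := 1 + (C + 1) * ((‖f‖ + 1) / δ) with hN₂
  have hN₁0 : 0 < N₁ := by positivity
  have hN₂0 : 0 < N₂ := by positivity
  set η₁ := 1 / (2 * N₁) with hη₁
  set η₂ := 1 / (2 * N₂) with hη₂
  have hη₁0 : 0 < η₁ := by positivity
  have hη₂0 : 0 < η₂ := by positivity
  -- The factor `‖f‖ + 1` absorbs the application of `f`; the cap `1` serves to bound the
  -- displacement `P (u x, x) - x`.
  obtain ⟨ε₁, hε₁, he₁⟩ := hest (min 1 (η₁ / (‖f‖ + 1))) (by positivity)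
  obtain ⟨ε₂, hε₂, he₂⟩ := hest (η₂ / 4) (by positivity)
  -- This keeps `W (y + v)` within `η₂ / 2` of `W y`; the other half of `η₂` is two terms with
  -- coefficient `η₂ / 4`.
  set ε₃ := η₂ / (2 * (|K| + 1)) with hε₃
  have hε₃0 : 0 < ε₃ := by positivity
  set ε := min ε₁ (min ε₂ ε₃) with hε
  have hε0 : 0 < ε := by positivity
  have hsmall : ∀ᶠ c in 𝓝 c₀, ‖c - c₀‖ < r ∧ 2 * N₁ * (C + 2) * ‖c - c₀‖ < ε ∧
      2 * N₂ * ‖c - c₀‖ < ε := by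
    have ht : Tendsto (fun c => ‖c - c₀‖) (𝓝 c₀) (𝓝 0) :=
      tendsto_iff_norm_sub_tendsto_zero.1 tendsto_id
    refine (ht.eventually_lt_const hr).and (Eventually.and ?_ ?_)
    · have := ht.const_mul (2 * N₁ * (C + 2))
      rw [mul_zero] at this
      exact this.eventually_lt_const hε0
    · have := ht.const_mul (2 * N₂)
      rw [mul_zero] at this
      exact this.eventually_lt_const hε0
  filter_upwards [hsmall] with c hc
  obtain ⟨hcr, hc1, hc2⟩ := hc
  -- the shift of the fibre over `c₀`
  have hfw : ∃ u : E → ℂ, ∀ x ∈ fibre M f c₀, ‖u x‖ ≤ 2 * N₁ * ‖c - c₀‖ ∧ f (P (u x, x)) - c = 0 ∧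
      (∀ z, ‖z‖ < ε → f (P (z, x)) - c = 0 → z = u x) ∧
      ∃ σ : E → ℂ, ContDiffAt ℝ ω σ x ∧ ∀ᶠ y in 𝓝 x, y ∈ fibre M f c₀ → u y = σ y := by
    have key := exists_small_solution (X := E) (Z := ℂ) (G := fun q => f (P (q.2, q.1)) - c)
      (A := fibre M f c₀) (L := fun x => (ContinuousLinearMap.mul ℝ ℂ) (f (W x)))
      (N := N₁) (η := η₁) (ε := ε) ?_ hN₁0 hη₁0.le (by rw [hη₁]; field_simp; exact le_rfl) ?_ ?_ ?_
    · obtain ⟨u, hu⟩ := key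
      refine ⟨u, fun x hx => ?_⟩
      have := hu x hx
      simp only [h0, hx.2] at this
      rwa [norm_sub_rev] at this
    · exact ((f.restrictScalars ℝ).contDiff.comp
        (hP.comp (contDiff_snd.prodMk contDiff_fst))).sub contDiff_const
    · intro x hx z
      have h1 := hW x hx.1 (by rw [hx.2]; simpa using hr.le)
      rw [ContinuousLinearMap.mul_apply', norm_mul, hN₁, inv_mul_eq_div, le_div_iff₀ hδ, mul_comm]
      gcongr
    · intro x hx z z' hz hz'
      have h1 := he₁ z z' x x (hz.trans_le (min_le_left _ _)) (hz'.trans_le (min_le_left _ _))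
      rw [sub_self, norm_zero, zero_add, sub_zero] at h1
      have h2 : f (P (z, x)) - c - (f (P (z', x)) - c) -
          (ContinuousLinearMap.mul ℝ ℂ) (f (W x)) (z - z') =
          f (P (z, x) - P (z', x) - (z - z') • W x) := by
        simp only [ContinuousLinearMap.mul_apply', map_sub, map_smul, smul_eq_mul]
        ring
      rw [h2]
      calc _ ≤ ‖f‖ * ‖P (z, x) - P (z', x) - (z - z') • W x‖ := f.le_opNorm _
        _ ≤ ‖f‖ * (η₁ / (‖f‖ + 1) * ‖z - z'‖) := by
            gcongr
            exact h1.trans (by gcongr; exact min_le_right _ _)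
        _ = (‖f‖ / (‖f‖ + 1)) * (η₁ * ‖z - z'‖) := by ring
        _ ≤ 1 * (η₁ * ‖z - z'‖) := by
            gcongr
            rw [div_le_one (by positivity)]
            linarith
        _ = _ := one_mul _
    · intro x hx
      simp only [h0, hx.2]
      rw [norm_sub_rev]
      refine lt_of_le_of_lt ?_ hc1
      nlinarith [mul_nonneg (mul_nonneg hN₁0.le (norm_nonneg (c - c₀))) hC,
        mul_nonneg hN₁0.le (norm_nonneg (c - c₀))]
  -- the inverse shift of the fibre over `c`
  have hbw : ∃ w : E → E × ℂ, ∀ y ∈ fibre M f c, ‖w y‖ ≤ 2 * N₂ * ‖c - c₀‖ ∧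
      (P ((w y).2, y + (w y).1) - y = 0 ∧ f (y + (w y).1) - c₀ = 0) ∧
      (∀ z : E × ℂ, ‖z‖ < ε → (P (z.2, y + z.1) - y = 0 ∧ f (y + z.1) - c₀ = 0) → z = w y) ∧
      ∃ σ : E → E × ℂ, ContDiffAt ℝ ω σ y ∧ ∀ᶠ y' in 𝓝 y, y' ∈ fibre M f c → w y' = σ y' := by
    have key := exists_small_solution (X := E) (Z := E × ℂ)
      (G := fun q => (P (q.2.2, q.1 + q.2.1) - q.1, f (q.1 + q.2.1) - c₀))
      (A := fibre M f c) (L := fun y => ((ContinuousLinearMap.fst ℝ E ℂ +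
        (ContinuousLinearMap.snd ℝ E ℂ).smulRight (W y)).prod
          (f.restrictScalars ℝ ∘L ContinuousLinearMap.fst ℝ E ℂ)))
      (N := N₂) (η := η₂) (ε := ε) ?_ hN₂0 hη₂0.le (by rw [hη₂]; field_simp; exact le_rfl) ?_ ?_ ?_
    · obtain ⟨w, hw⟩ := key
      refine ⟨w, fun y hy => ?_⟩
      have := hw y hy
      simp only [Prod.fst_zero, Prod.snd_zero, h0, hy.2, add_zero, sub_self, Prod.mk_eq_zero,
        Prod.norm_mk, norm_zero, norm_nonneg, max_eq_right] at this
      exact this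
    · refine ContDiff.prodMk ((hP.comp ((contDiff_snd.comp contDiff_snd).prodMk
        (contDiff_fst.add (contDiff_fst.comp contDiff_snd)))).sub contDiff_fst) ?_
      exact ((f.restrictScalars ℝ).contDiff.comp
        (contDiff_fst.add (contDiff_fst.comp contDiff_snd))).sub contDiff_const
    · rintro y hy ⟨v, s⟩
      have h1 := hW y hy.1 (by rw [hy.2]; exact hcr.le)
      set m := ‖(v + s • W y, f v)‖ with hm
      have hm1 : ‖v + s • W y‖ ≤ m := norm_fst_le (v + s • W y, f v)
      have hm2 : ‖f v‖ ≤ m := norm_snd_le (v + s • W y, f v)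
      -- Applying `f` to the first component and subtracting the second isolates `s f (W y)`.
      have hs : ‖s‖ ≤ (‖f‖ + 1) / δ * m := by
        rw [div_mul_eq_mul_div, le_div_iff₀ hδ]
        have e1 : s * f (W y) = f (v + s • W y) - f v := by simp
        calc ‖s‖ * δ ≤ ‖s‖ * ‖f (W y)‖ := by gcongr
          _ = ‖f (v + s • W y) - f v‖ := by rw [← norm_mul, e1]
          _ ≤ ‖f (v + s • W y)‖ + ‖f v‖ := norm_sub_le _ _
          _ ≤ ‖f‖ * m + m := add_le_add ((f.le_opNorm _).trans (by gcongr)) hm2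
          _ = _ := by ring
      have hv : ‖v‖ ≤ m + C * ((‖f‖ + 1) / δ * m) := by
        calc ‖v‖ = ‖(v + s • W y) - s • W y‖ := by rw [add_sub_cancel_right]
          _ ≤ ‖v + s • W y‖ + ‖s • W y‖ := norm_sub_le _ _
          _ ≤ m + C * ((‖f‖ + 1) / δ * m) := by
            rw [norm_smul, mul_comm C]
            gcongr
            exact hWC y
      have hm0 : 0 ≤ m := norm_nonneg _
      have ht : 0 ≤ (‖f‖ + 1) / δ * m := by positivity
      change ‖(v, s)‖ ≤ N₂ * m
      rw [Prod.norm_mk, hN₂]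
      refine max_le ?_ ?_
      · linarith
      · nlinarith [mul_nonneg hC ht]
    · rintro y hy ⟨v, s⟩ ⟨v', s'⟩ hz hz'
      have hv' : ‖v'‖ < ε := (norm_fst_le (v', s')).trans_lt hz'
      have hs : ‖s‖ < ε₂ := ((norm_snd_le (v, s)).trans_lt hz).trans_le
        ((min_le_right _ _).trans (min_le_left _ _))
      have hs' : ‖s'‖ < ε₂ := ((norm_snd_le (v', s')).trans_lt hz').trans_le
        ((min_le_right _ _).trans (min_le_left _ _))
      have h1 := he₂ s s' (y + v) (y + v') hs hs'
      rw [add_sub_add_left_eq_sub] at h1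
      have h2 : ‖W (y + v') - W y‖ ≤ η₂ / 2 := by
        calc _ ≤ K * ‖y + v' - y‖ := hWK _ _
          _ ≤ (|K| + 1) * ε₃ := by
            rw [add_sub_cancel_left]
            gcongr
            · linarith [le_abs_self K]
            · exact hv'.le.trans ((min_le_right _ _).trans (min_le_right _ _))
          _ = _ := by rw [hε₃]; field_simp
      have h3 : ((P (s, y + v) - y, f (y + v) - c₀) - (P (s', y + v') - y, f (y + v') - c₀) -
          ((v - v') + (s - s') • W y, f (v - v')) : E × ℂ) =
          ((P (s, y + v) - P (s', y + v') - (v - v') - (s - s') • W (y + v')) +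
            (s - s') • (W (y + v') - W y), 0) := by
        ext
        · simp only [Prod.fst_sub, smul_sub]
          abel
        · simp
      change ‖((P (s, y + v) - y, f (y + v) - c₀) - (P (s', y + v') - y, f (y + v') - c₀) -
          ((v - v') + (s - s') • W y, f (v - v')) : E × ℂ)‖ ≤ η₂ * ‖(v - v', s - s')‖
      rw [h3, Prod.norm_mk, norm_zero, max_eq_left (norm_nonneg _)]
      have h4 : ‖v - v'‖ ≤ ‖(v - v', s - s')‖ := norm_fst_le (v - v', s - s')
      have h5 : ‖s - s'‖ ≤ ‖(v - v', s - s')‖ := norm_snd_le (v - v', s - s')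
      calc _ ≤ η₂ / 4 * (‖v - v'‖ + ‖s - s'‖) + ‖s - s'‖ * (η₂ / 2) := by
            refine (norm_add_le _ _).trans (add_le_add h1 ?_)
            rw [norm_smul]
            gcongr
        _ ≤ η₂ / 4 * (‖(v - v', s - s')‖ + ‖(v - v', s - s')‖) +
            ‖(v - v', s - s')‖ * (η₂ / 2) := by gcongr
        _ = _ := by ring
    · intro y hy
      simp only [Prod.fst_zero, Prod.snd_zero, h0, hy.2, add_zero, sub_self,
        Prod.norm_mk, norm_zero, norm_nonneg, max_eq_right]
      exact hc2
  obtain ⟨u, hu⟩ := hfw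
  obtain ⟨w, hw⟩ := hbw
  refine ⟨fun x => P (u x, x), fun y => y + (w y).1, ?_, ?_, ⟨?_, ?_⟩, ?_, ?_⟩
  · intro x hx
    exact ⟨(hM _ _).2 hx.1, sub_eq_zero.1 (hu x hx).2.1⟩
  · intro y hy
    have h1 := (hw y hy).2.1
    refine ⟨(hM (w y).2 _).1 ?_, sub_eq_zero.1 h1.2⟩
    rw [sub_eq_zero.1 h1.1]
    exact hy.1
  · intro x hx
    set y := P (u x, x) with hy
    have hyf : y ∈ fibre M f c := ⟨(hM _ _).2 hx.1, sub_eq_zero.1 (hu x hx).2.1⟩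
    have hux := (hu x hx).1
    have hux' : ‖u x‖ < ε := by
      refine hux.trans_lt (lt_of_le_of_lt ?_ hc1)
      nlinarith [mul_nonneg (mul_nonneg hN₁0.le (norm_nonneg (c - c₀))) hC,
        mul_nonneg hN₁0.le (norm_nonneg (c - c₀))]
    have hxy : ‖x - y‖ < ε := by
      have h1 := he₁ (u x) 0 x x (hux'.trans_le (min_le_left _ _)) (by simpa using hε₁)
      rw [sub_self, norm_zero, zero_add, sub_zero, sub_zero, h0] at h1
      have h2 : ‖y - x - u x • W x‖ ≤ ‖u x‖ := h1.trans
        (mul_le_of_le_one_left (norm_nonneg _) (min_le_left _ _))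
      calc ‖x - y‖ = ‖(y - x - u x • W x) + u x • W x‖ := by
            rw [norm_sub_rev, sub_add_cancel]
        _ ≤ ‖u x‖ + ‖u x‖ * C := by
            refine (norm_add_le _ _).trans (add_le_add h2 ?_)
            rw [norm_smul]
            gcongr
            exact hWC x
        _ ≤ 2 * N₁ * ‖c - c₀‖ + 2 * N₁ * ‖c - c₀‖ * C := by gcongr
        _ ≤ 2 * N₁ * (C + 2) * ‖c - c₀‖ := by
            nlinarith [mul_nonneg hN₁0.le (norm_nonneg (c - c₀))]
        _ < ε := hc1
    -- The pair `(x - y, u x)` is a small solution of the backward equation, hence equals `w y`.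
    have h3 := (hw y hyf).2.2.1 (x - y, u x) (by
      rw [Prod.norm_mk]; exact max_lt hxy hux') ⟨by simp [hy], by simp [hx.2]⟩
    change y + (w y).1 = x
    rw [← h3, add_sub_cancel]
  · intro y hy
    have h1 := (hw y hy).2.1
    have hx : y + (w y).1 ∈ fibre M f c₀ := by
      refine ⟨(hM (w y).2 _).1 ?_, sub_eq_zero.1 h1.2⟩
      rw [sub_eq_zero.1 h1.1]
      exact hy.1
    have hw2 : ‖(w y).2‖ < ε := ((norm_snd_le (w y)).trans (hw y hy).1).trans_lt hc2
    have h3 := (hu _ hx).2.2.1 (w y).2 hw2 (by rw [sub_eq_zero.1 h1.1, hy.2, sub_self])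
    change P (u (y + (w y).1), y + (w y).1) = y
    rw [← h3]
    exact sub_eq_zero.1 h1.1
  · refine smoothOnSubmanifold_of_contDiffAt fun x hx => ?_
    obtain ⟨σ, hσ, he⟩ := (hu x hx).2.2.2
    exact ⟨fun x => P (σ x, x), hP.contDiffAt.comp x (hσ.prodMk contDiffAt_id),
      he.mono fun y h hy => by rw [h hy]⟩
  · refine smoothOnSubmanifold_of_contDiffAt fun y hy => ?_
    obtain ⟨σ, hσ, he⟩ := (hw y hy).2.2.2
    exact ⟨fun y => y + (σ y).1, contDiffAt_id.add hσ.fst,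
      he.mono fun y h hy => by rw [h hy]⟩

end ShiftFibres

/-! ### Uniform estimates for exponential families -/

section ExpFamilies

variable {E : Type*} [NormedAddCommGroup E] [NormedSpace ℂ E] [FiniteDimensional ℂ E]

/-- Estimates for the family `(s, x) ↦ exp (s A(x)) x`, for an operator-valued map `A` decaying
at infinity. -/
theorem exists_norm_exp_smul_apply_sub_le {A : E → E →L[ℂ] E} {C : ℝ} (h0 : ∀ x, ‖A x‖ ≤ C)
    (h1 : ∀ x, ‖A x‖ * ‖x‖ ≤ C)
    (h2 : ∀ x x', ‖A x - A x'‖ * min ‖x‖ ‖x'‖ ≤ C * ‖x - x'‖) :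
    ∀ η > 0, ∃ ε > 0, ∀ (s s' : ℂ) x x', ‖s‖ < ε → ‖s'‖ < ε →
      ‖NormedSpace.exp (s • A x) x - NormedSpace.exp (s' • A x') x' - (x - x') -
        (s - s') • A x' x'‖ ≤ η * (‖x - x'‖ + ‖s - s'‖) := by
  have hC : 0 ≤ C := (norm_nonneg _).trans (h0 0)
  have hexp := (hasStrictFDerivAt_exp_zero (𝕂 := ℂ) (𝔸 := E →L[ℂ] E)).isLittleO
  intro η hη
  set κ := min 1 (η / (4 * (C + 1))) with hκ
  have hκ0 : 0 < κ := by positivity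
  have hκ1 : κ * (4 * (C + 1)) ≤ η := (le_div_iff₀ (by positivity)).1 (min_le_right _ _)
  obtain ⟨ρ, hρ, hb⟩ := Metric.eventually_nhds_iff.1 ((Asymptotics.isLittleO_iff.1 hexp) hκ0)
  have hb' : ∀ a b : E →L[ℂ] E, ‖a‖ < ρ → ‖b‖ < ρ →
      ‖NormedSpace.exp a - NormedSpace.exp b - (a - b)‖ ≤ κ * ‖a - b‖ := fun a b ha hb' => by
    have := @hb (a, b) (by rw [dist_eq_norm, Prod.norm_def]; simpa using ⟨ha, hb'⟩)
    simpa using this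
  have hb2 : ∀ a b : E →L[ℂ] E, ‖a‖ < ρ → ‖b‖ < ρ →
      ‖NormedSpace.exp a - NormedSpace.exp b‖ ≤ 2 * ‖a - b‖ := fun a b ha hb => by
    have h3 := hb' a b ha hb
    have h4 : κ * ‖a - b‖ ≤ 1 * ‖a - b‖ := by gcongr; exact min_le_left _ _
    calc _ = ‖(NormedSpace.exp a - NormedSpace.exp b - (a - b)) + (a - b)‖ := by
          rw [sub_add_cancel]
      _ ≤ _ := norm_add_le _ _
      _ ≤ _ := by linarith
  refine ⟨min κ (ρ / (C + 1)), by positivity, fun s s' x x' hs hs' => ?_⟩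
  have hsm : ∀ (t : ℂ) z, ‖t‖ < min κ (ρ / (C + 1)) → ‖t • A z‖ < ρ ∧ ‖t • A z‖ ≤ κ * C :=
      fun t z ht => by
    have h3 := (lt_div_iff₀ (by positivity)).1 (ht.trans_le (min_le_right _ _))
    have h4 := ht.trans_le (min_le_left _ _)
    rw [norm_smul]
    constructor
    · refine lt_of_le_of_lt ?_ h3
      gcongr
      linarith [h0 z]
    · gcongr
      exact h0 z
  -- The increment is split into a change of `s` at the fixed point `x'` and a change of the point
  -- at fixed `s`.
  have hT2 : ‖NormedSpace.exp (s • A x') x' - NormedSpace.exp (s' • A x') x' -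
      (s - s') • A x' x'‖ ≤ κ * C * ‖s - s'‖ := by
    have h3 := hb' (s • A x') (s' • A x') (hsm s x' hs).1 (hsm s' x' hs').1
    rw [← sub_smul, norm_smul] at h3
    calc _ = ‖(NormedSpace.exp (s • A x') - NormedSpace.exp (s' • A x') -
          (s - s') • A x') x'‖ := by simp
      _ ≤ κ * (‖s - s'‖ * ‖A x'‖) * ‖x'‖ :=
        ContinuousLinearMap.le_of_opNorm_le _ h3 x'
      _ = κ * (‖A x'‖ * ‖x'‖) * ‖s - s'‖ := by ring
      _ ≤ _ := by gcongr; exact h1 x'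
  have hone : ∀ z v, ‖NormedSpace.exp (s • A z) v - v‖ ≤ 2 * (κ * C) * ‖v‖ := fun z v => by
    have h3 := hb2 (s • A z) 0 (hsm s z hs).1 (by simpa using hρ)
    rw [sub_zero, NormedSpace.exp_zero] at h3
    exact ContinuousLinearMap.le_of_opNorm_le (NormedSpace.exp (s • A z) - 1)
      (h3.trans (by gcongr; exact (hsm s z hs).2)) v
  -- The difference of exponentials only ever acts on the shorter vector, where `h2` controls it.
  have hdiff : ∀ v, ‖v‖ ≤ min ‖x‖ ‖x'‖ →
      ‖(NormedSpace.exp (s • A x) - NormedSpace.exp (s • A x')) v‖ ≤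
        2 * (κ * C) * ‖x - x'‖ := fun v hv => by
    have h3 := hb2 (s • A x) (s • A x') (hsm s x hs).1 (hsm s x' hs).1
    rw [← smul_sub, norm_smul] at h3
    calc _ ≤ 2 * (‖s‖ * ‖A x - A x'‖) * ‖v‖ := ContinuousLinearMap.le_of_opNorm_le _ h3 v
      _ ≤ 2 * (κ * ‖A x - A x'‖) * min ‖x‖ ‖x'‖ := by
        gcongr
        exact hs.le.trans (min_le_left _ _)
      _ = 2 * κ * (‖A x - A x'‖ * min ‖x‖ ‖x'‖) := by ring
      _ ≤ 2 * κ * (C * ‖x - x'‖) := mul_le_mul_of_nonneg_left (h2 x x') (by positivity)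
      _ = _ := by ring
  have hT1 : ‖NormedSpace.exp (s • A x) x - NormedSpace.exp (s • A x') x' - (x - x')‖ ≤
      4 * (κ * C) * ‖x - x'‖ := by
    rcases le_total ‖x‖ ‖x'‖ with h | h
    · calc _ = ‖(NormedSpace.exp (s • A x') (x - x') - (x - x')) +
            (NormedSpace.exp (s • A x) - NormedSpace.exp (s • A x')) x‖ := by
            rw [map_sub, sub_apply]; congr 1; abel
        _ ≤ _ := (norm_add_le _ _).trans (add_le_add (hone x' _) (hdiff x (le_min le_rfl h)))
        _ = _ := by ring
    · calc _ = ‖(NormedSpace.exp (s • A x) (x - x') - (x - x')) +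
            (NormedSpace.exp (s • A x) - NormedSpace.exp (s • A x')) x'‖ := by
            rw [map_sub, sub_apply]; congr 1; abel
        _ ≤ _ := (norm_add_le _ _).trans (add_le_add (hone x _) (hdiff x' (le_min h le_rfl)))
        _ = _ := by ring
  calc _ = ‖(NormedSpace.exp (s • A x) x - NormedSpace.exp (s • A x') x' - (x - x')) +
        (NormedSpace.exp (s • A x') x' - NormedSpace.exp (s' • A x') x' -
          (s - s') • A x' x')‖ := by congr 1; abel
    _ ≤ 4 * (κ * C) * ‖x - x'‖ + κ * C * ‖s - s'‖ := (norm_add_le _ _).trans (add_le_add hT1 hT2)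
    _ ≤ η * ‖x - x'‖ + η * ‖s - s'‖ := by
      gcongr
      · nlinarith
      · nlinarith
    _ = _ := by ring

theorem norm_apply_sub_apply_le {A : E → E →L[ℂ] E} {C : ℝ} (h0 : ∀ x, ‖A x‖ ≤ C)
    (h2 : ∀ x x', ‖A x - A x'‖ * min ‖x‖ ‖x'‖ ≤ C * ‖x - x'‖) (x x' : E) :
    ‖A x x - A x' x'‖ ≤ 2 * C * ‖x - x'‖ := by
  rcases le_total ‖x‖ ‖x'‖ with h | h
  · have h3 := h2 x x'
    rw [min_eq_left h] at h3
    calc _ = ‖A x' (x - x') + (A x - A x') x‖ := by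
          rw [map_sub, sub_apply]; congr 1; abel
      _ ≤ ‖A x'‖ * ‖x - x'‖ + ‖A x - A x'‖ * ‖x‖ :=
        (norm_add_le _ _).trans (add_le_add ((A x').le_opNorm _) ((A x - A x').le_opNorm _))
      _ ≤ C * ‖x - x'‖ + C * ‖x - x'‖ := by gcongr; exact h0 x'
      _ = _ := by ring
  · have h3 := h2 x x'
    rw [min_eq_right h] at h3
    calc _ = ‖A x (x - x') + (A x - A x') x'‖ := by
          rw [map_sub, sub_apply]; congr 1; abel
      _ ≤ ‖A x‖ * ‖x - x'‖ + ‖A x - A x'‖ * ‖x'‖ :=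
        (norm_add_le _ _).trans (add_le_add ((A x).le_opNorm _) ((A x - A x').le_opNorm _))
      _ ≤ C * ‖x - x'‖ + C * ‖x - x'‖ := by gcongr; exact h0 x
      _ = _ := by ring

/-- Boundedness and Lipschitz properties of a linear map rescaled by a Hermitian norm. -/
theorem exists_rescaled_bounds {F : Type*} [NormedAddCommGroup F] [NormedSpace ℂ F]
    (e : E ≃L[ℂ] F) (Z : E →L[ℝ] E) : ∃ C : ℝ,
    (∀ x, ‖(1 + ‖e x‖ ^ 2)⁻¹ • Z x‖ ≤ C) ∧ (∀ x, ‖(1 + ‖e x‖ ^ 2)⁻¹ • Z x‖ * ‖x‖ ≤ C) ∧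
    ∀ x x', ‖(1 + ‖e x‖ ^ 2)⁻¹ • Z x - (1 + ‖e x'‖ ^ 2)⁻¹ • Z x'‖ * min ‖x‖ ‖x'‖ ≤
      C * ‖x - x'‖ := by
  set z := ‖Z‖ with hz
  set c := ‖(e.symm : F →L[ℂ] E)‖ with hc
  set d := ‖(e : E →L[ℂ] F)‖ with hd
  have hz0 : 0 ≤ z := norm_nonneg _
  have hc0 : 0 ≤ c := norm_nonneg _
  have hd0 : 0 ≤ d := norm_nonneg _
  have hxe : ∀ x, ‖x‖ ≤ c * ‖e x‖ := fun x => by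
    simpa using (e.symm : F →L[ℂ] E).le_opNorm (e x)
  have hZ : ∀ x, ‖Z x‖ ≤ z * (c * ‖e x‖) := fun x => (Z.le_opNorm x).trans (by gcongr; exact hxe x)
  have hpos : ∀ x, 0 < 1 + ‖e x‖ ^ 2 := fun x => by positivity
  have hn : ∀ x, ‖(1 + ‖e x‖ ^ 2)⁻¹ • Z x‖ = (1 + ‖e x‖ ^ 2)⁻¹ * ‖Z x‖ := fun x => by
    rw [norm_smul, Real.norm_of_nonneg (inv_nonneg.2 (hpos x).le)]
  have hle1 : ∀ x, (1 + ‖e x‖ ^ 2)⁻¹ * ‖e x‖ ≤ 1 := fun x => by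
    rw [inv_mul_le_one₀ (hpos x)]
    nlinarith [sq_nonneg (‖e x‖ - 1), norm_nonneg (e x)]
  have hle2 : ∀ x, (1 + ‖e x‖ ^ 2)⁻¹ * ‖e x‖ ^ 2 ≤ 1 := fun x => by
    rw [inv_mul_le_one₀ (hpos x)]
    linarith
  have key : ∀ x x', ‖e x'‖ ≤ ‖e x‖ →
      ‖(1 + ‖e x‖ ^ 2)⁻¹ • Z x - (1 + ‖e x'‖ ^ 2)⁻¹ • Z x'‖ * ‖x'‖ ≤
      (z * c + 2 * z * c ^ 2 * d) * ‖x - x'‖ := fun x x' hxx => by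
    set a := ‖e x‖ with ha
    set b := ‖e x'‖ with hb
    have ha0 : 0 ≤ a := norm_nonneg _
    have hb0 : 0 ≤ b := norm_nonneg _
    have hA := inv_nonneg.2 (hpos x).le
    have hB := inv_nonneg.2 (hpos x').le
    have hab : a - b ≤ d * ‖x - x'‖ := by
      refine (norm_sub_norm_le _ _).trans ?_
      rw [← map_sub]
      exact (e : E →L[ℂ] F).le_opNorm (x - x')
    -- The first term is weighted at the point of larger norm. The second carries the difference of
    -- the weights, which has the Lipschitz factor `a - b`.
    have hsplit : (1 + a ^ 2)⁻¹ • Z x - (1 + b ^ 2)⁻¹ • Z x' =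
        (1 + a ^ 2)⁻¹ • Z (x - x') -
          ((1 + a ^ 2)⁻¹ * (1 + b ^ 2)⁻¹ * ((a - b) * (a + b))) • Z x' := by
      have e1 : (1 + a ^ 2)⁻¹ * (1 + b ^ 2)⁻¹ * ((a - b) * (a + b)) =
          (1 + b ^ 2)⁻¹ - (1 + a ^ 2)⁻¹ := by
        have := (hpos x).ne'
        have := (hpos x').ne'
        field_simp
        ring
      rw [e1, map_sub, smul_sub, sub_smul]
      abel
    have hx1 : ‖(1 + a ^ 2)⁻¹ • Z (x - x')‖ * ‖x'‖ ≤ z * c * ‖x - x'‖ := by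
      rw [norm_smul, Real.norm_of_nonneg hA]
      calc _ ≤ (1 + a ^ 2)⁻¹ * (z * ‖x - x'‖) * (c * a) := by
            gcongr
            · exact Z.le_opNorm _
            · exact (hxe x').trans (by gcongr)
        _ = z * c * ‖x - x'‖ * ((1 + a ^ 2)⁻¹ * a) := by ring
        _ ≤ z * c * ‖x - x'‖ * 1 := by gcongr; exact hle1 x
        _ = _ := mul_one _
    have hx2 : ‖((1 + a ^ 2)⁻¹ * (1 + b ^ 2)⁻¹ * ((a - b) * (a + b))) • Z x'‖ * ‖x'‖ ≤
        2 * z * c ^ 2 * d * ‖x - x'‖ := by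
      have hab0 : 0 ≤ a - b := sub_nonneg.2 hxx
      rw [norm_smul, Real.norm_of_nonneg (by positivity)]
      calc _ ≤ ((1 + a ^ 2)⁻¹ * (1 + b ^ 2)⁻¹ * ((d * ‖x - x'‖) * (a + a))) * (z * (c * b)) *
            (c * b) := by
            gcongr
            · exact hZ x'
            · exact hxe x'
        _ = 2 * z * c ^ 2 * d * ‖x - x'‖ * ((1 + a ^ 2)⁻¹ * a) * ((1 + b ^ 2)⁻¹ * b ^ 2) := by ring
        _ ≤ 2 * z * c ^ 2 * d * ‖x - x'‖ * 1 * 1 := by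
            gcongr
            · exact hle1 x
            · exact hle2 x'
        _ = _ := by ring
    rw [hsplit]
    calc _ ≤ (‖(1 + a ^ 2)⁻¹ • Z (x - x')‖ +
          ‖((1 + a ^ 2)⁻¹ * (1 + b ^ 2)⁻¹ * ((a - b) * (a + b))) • Z x'‖) * ‖x'‖ := by
          gcongr
          exact norm_sub_le _ _
      _ ≤ _ := by linarith
  refine ⟨z * c + z * c ^ 2 + (z * c + 2 * z * c ^ 2 * d), fun x => ?_, fun x => ?_,
    fun x x' => ?_⟩
  · calc _ ≤ (1 + ‖e x‖ ^ 2)⁻¹ * (z * (c * ‖e x‖)) := by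
          rw [hn]
          exact mul_le_mul_of_nonneg_left (hZ x) (inv_nonneg.2 (hpos x).le)
      _ = z * c * ((1 + ‖e x‖ ^ 2)⁻¹ * ‖e x‖) := by ring
      _ ≤ z * c * 1 := by gcongr; exact hle1 x
      _ ≤ _ := by
        have : 0 ≤ z * c ^ 2 + (z * c + 2 * z * c ^ 2 * d) := by positivity
        linarith
  · calc _ ≤ (1 + ‖e x‖ ^ 2)⁻¹ * (z * (c * ‖e x‖)) * (c * ‖e x‖) := by
          rw [hn]
          have := inv_nonneg.2 (hpos x).le
          gcongr
          · exact hZ x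
          · exact hxe x
      _ = z * c ^ 2 * ((1 + ‖e x‖ ^ 2)⁻¹ * ‖e x‖ ^ 2) := by ring
      _ ≤ z * c ^ 2 * 1 := by gcongr; exact hle2 x
      _ ≤ _ := by
        have : 0 ≤ z * c + (z * c + 2 * z * c ^ 2 * d) := by positivity
        linarith
  · have hfin : (z * c + 2 * z * c ^ 2 * d) * ‖x - x'‖ ≤
        (z * c + z * c ^ 2 + (z * c + 2 * z * c ^ 2 * d)) * ‖x - x'‖ := by
      refine mul_le_mul_of_nonneg_right ?_ (norm_nonneg _)
      have : 0 ≤ z * c + z * c ^ 2 := by positivity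
      linarith
    rcases le_total ‖e x'‖ ‖e x‖ with h | h
    · refine le_trans ?_ ((key x x' h).trans hfin)
      gcongr
      exact min_le_right _ _
    · have h3 := key x' x h
      rw [norm_sub_rev, norm_sub_rev x' x] at h3
      refine le_trans ?_ (h3.trans hfin)
      gcongr
      exact min_le_left _ _

end ExpFamilies

/-! ### Diffeomorphism of the regular fibres -/

section RegularFibres

open Filter Polynomial LieAlgebra

variable {𝔤 : Type*} [NormedLieRing 𝔤] [NormedLieAlgebra ℂ 𝔤] [FiniteDimensional ℂ 𝔤]
  [LieAlgebra.IsSemisimple ℂ 𝔤] {𝔥 : LieSubalgebra ℂ 𝔤} [𝔥.IsCartanSubalgebra]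

/-- The real linear map relating the Killing form to the Hermitian inner product. -/
theorem exists_killingForm_eq_inner : ∃ σ : 𝔤 →L[ℝ] 𝔤, ∀ v u,
    killingForm ℂ 𝔤 (σ v) u = inner ℂ (hermEquiv 𝔤 v) (hermEquiv 𝔤 u) := by
  have : FiniteDimensional ℝ 𝔤 := FiniteDimensional.complexToReal 𝔤
  have hB := IsKilling.killingForm_nondegenerate ℂ 𝔤
  have hex : ∀ v : 𝔤, ∃ w : 𝔤, ∀ u,
      killingForm ℂ 𝔤 w u = inner ℂ (hermEquiv 𝔤 v) (hermEquiv 𝔤 u) := fun v => by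
    let φ : Module.Dual ℂ 𝔤 := (innerₛₗ ℂ (hermEquiv 𝔤 v)) ∘ₗ (hermEquiv 𝔤 : 𝔤 →ₗ[ℂ] _)
    refine ⟨(LinearMap.BilinForm.toDual (killingForm ℂ 𝔤) hB).symm φ, fun u => ?_⟩
    rw [LinearMap.BilinForm.apply_toDual_symm_apply]
    rfl
  choose s hs using hex
  have huniq : ∀ w w' : 𝔤, (∀ u, killingForm ℂ 𝔤 w u = killingForm ℂ 𝔤 w' u) → w = w' :=
    fun w w' h => sub_eq_zero.1 (eq_zero_of_forall_killingForm fun u => by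
      rw [map_sub, LinearMap.sub_apply, h u, sub_self])
  -- The inner product is conjugate-linear in its first argument, so linearity holds over `ℝ` only.
  let σ : 𝔤 →ₗ[ℝ] 𝔤 :=
    { toFun := s
      map_add' := fun v v' => huniq _ _ fun u => by
        rw [hs, map_add, map_add, LinearMap.add_apply, hs, hs, inner_add_left]
      map_smul' := fun r v => huniq _ _ fun u => by
        have h1 : r • v = (r : ℂ) • v := rfl
        have h2 : r • s v = (r : ℂ) • s v := rfl
        rw [hs, h1, RingHom.id_apply, h2, map_smul, map_smul, LinearMap.smul_apply, hs,
          inner_smul_left, Complex.conj_ofReal, smul_eq_mul] }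
  exact ⟨LinearMap.toContinuousLinearMap σ, hs⟩

/-- The limits at infinity of `ad x`, for `x` in the set cut out by `p (ad x) = 0`, are
nilpotent; here in terms of homogeneous coordinates. -/
theorem pow_natDegree_eq_zero_of_mem_closure {p : ℂ[X]} (hp : p ≠ 0) {S : Set (𝔤 × ℝ)}
    (hS : ∀ q ∈ S, ∃ x ∈ adVariety p, q.1 = q.2 • x) {y : 𝔤} (hy : (y, (0 : ℝ)) ∈ closure S) :
    adL y ^ p.natDegree = 0 := by
  -- The homogenisation of `p`: it vanishes on `S`, hence on the closure, and at second coordinate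
  -- `0` only the leading term survives.
  let Φ : 𝔤 × ℝ → (𝔤 →L[ℂ] 𝔤) := fun q => ∑ i ∈ Finset.range (p.natDegree + 1),
    (p.coeff i * (q.2 : ℂ) ^ (p.natDegree - i)) • adL q.1 ^ i
  have hΦc : Continuous Φ := by
    refine continuous_finsetSum _ fun i _ => ?_
    have h1 : Continuous fun q : 𝔤 × ℝ => adL q.1 := adL.continuous.comp continuous_fst
    have h2 : Continuous fun q : 𝔤 × ℝ => (q.2 : ℂ) := Complex.continuous_ofReal.comp continuous_snd
    fun_prop
  have hΦ0 : S ⊆ {q | Φ q = 0} := by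
    rintro ⟨z, t⟩ hq
    obtain ⟨x, hx, hzx⟩ := hS _ hq
    have hz : adL z = (t : ℂ) • adL x := by
      rw [← map_smul]; exact congrArg adL hzx
    have hx' : aeval (adL x) p = 0 := hx
    rw [aeval_eq_sum_range] at hx'
    change Φ (z, t) = 0
    calc Φ (z, t) = ∑ i ∈ Finset.range (p.natDegree + 1),
          (t : ℂ) ^ p.natDegree • (p.coeff i • adL x ^ i) := by
          refine Finset.sum_congr rfl fun i hi => ?_
          have hi' : p.natDegree - i + i = p.natDegree :=
            Nat.sub_add_cancel (Nat.lt_succ_iff.1 (Finset.mem_range.1 hi))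
          dsimp only
          rw [hz, _root_.smul_pow, smul_smul, smul_smul, mul_assoc, ← pow_add, hi', mul_comm]
      _ = 0 := by rw [← Finset.smul_sum, hx', smul_zero]
  have hy' : Φ (y, 0) = 0 := closure_minimal hΦ0 (isClosed_singleton.preimage hΦc) hy
  have h1 : Φ (y, 0) = p.leadingCoeff • adL y ^ p.natDegree := by
    change ∑ i ∈ Finset.range (p.natDegree + 1), _ = _
    rw [Finset.sum_range_succ, Finset.sum_eq_zero fun i hi => ?_]
    · simp
    · have : p.natDegree - i ≠ 0 := Nat.sub_ne_zero_of_lt (Finset.mem_range.1 hi)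
      simp [this]
  rw [h1] at hy'
  exact (smul_eq_zero.1 hy').resolve_left (leadingCoeff_ne_zero.2 hp)

theorem eq_zero_of_pow_adL_eq_zero {x : 𝔤} (hx : x ∈ 𝔥) {d : ℕ} (h : adL x ^ d = 0) : x = 0 := by
  refine IsKilling.eq_zero_of_isNilpotent_ad_of_mem_isCartanSubalgebra ℂ 𝔤 𝔥 hx ⟨d, ?_⟩
  ext v
  have h1 : ∀ k : ℕ, (ad ℂ 𝔤 x ^ k) v = (adL x ^ k) v := fun k => by
    induction k with
    | zero => rfl
    | succ k ih => rw [pow_succ', pow_succ', Module.End.mul_apply, ih]; rfl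
  rw [h1, h]
  rfl

/-- Away from the critical values, `[H, x]` is uniformly large in comparison with `x`. -/
theorem exists_le_norm_lie_div {p : ℂ[X]} (hp : Squarefree p) {H₀ : 𝔤} (hH₀ : H₀ ∈ adVariety p)
    {H : 𝔥} (hH : IsRegularElement H) {c₀ : ℂ} {r : ℝ}
    (hr : ∀ c, ‖c - c₀‖ ≤ r → IsRegularValue (adjointOrbit H₀) (heightFunction (H : 𝔤)) c) :
    ∃ δ > 0, ∀ x ∈ adjointOrbit H₀, ‖heightFunction (H : 𝔤) x - c₀‖ ≤ r →
      δ ≤ (1 + ‖hermEquiv 𝔤 x‖ ^ 2)⁻¹ * ‖hermEquiv 𝔤 ⁅(H : 𝔤), x⁆‖ ^ 2 := by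
  have : ProperSpace 𝔤 := FiniteDimensional.proper ℂ 𝔤
  set e := hermEquiv 𝔤 with he
  set M' : Set 𝔤 := {x | x ∈ adjointOrbit H₀ ∧ ‖heightFunction (H : 𝔤) x - c₀‖ ≤ r} with hM'
  have hM'c : IsClosed M' := (isClosed_adjointOrbit hp hH₀).inter
    (isClosed_le ((heightL (H : 𝔤)).continuous.sub continuous_const).norm continuous_const)
  -- The factor `θ x` normalises `(x, 1)`, so `S` lies on a sphere; points of its closure with
  -- second coordinate `0` are the limit directions at infinity.
  let θ : 𝔤 → ℝ := fun x => (√(1 + ‖e x‖ ^ 2))⁻¹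
  have hθ0 : ∀ x, 0 < θ x := fun x => by positivity
  have hθ2 : ∀ x, θ x ^ 2 = (1 + ‖e x‖ ^ 2)⁻¹ := fun x => by
    rw [inv_pow, Real.sq_sqrt (by positivity)]
  have hsm : ∀ (t : ℝ) (x : 𝔤), ‖e (t • x)‖ ^ 2 = t ^ 2 * ‖e x‖ ^ 2 := fun t x => by
    have : t • x = (t : ℂ) • x := rfl
    rw [this, map_smul, norm_smul, mul_pow, Complex.norm_real, Real.norm_eq_abs, sq_abs]
  set S : Set (𝔤 × ℝ) := (fun x => (θ x • x, θ x)) '' M' with hS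
  have hadL : ∀ y, ⁅(H : 𝔤), y⁆ = adL (H : 𝔤) y := fun y => rfl
  have hlie : ∀ (t : ℝ) (x : 𝔤), ⁅(H : 𝔤), t • x⁆ = t • ⁅(H : 𝔤), x⁆ := fun t x => by
    rw [hadL, hadL]; exact (adL (H : 𝔤)).map_smul (t : ℂ) x
  have hone : ∀ q ∈ closure S, ‖e q.1‖ ^ 2 + q.2 ^ 2 = 1 := by
    have hc : IsClosed {q : 𝔤 × ℝ | ‖e q.1‖ ^ 2 + q.2 ^ 2 = 1} :=
      isClosed_eq (((e.continuous.comp continuous_fst).norm.pow 2).add (continuous_snd.pow 2))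
        continuous_const
    refine fun q hq => closure_minimal ?_ hc hq
    rintro _ ⟨x, -, rfl⟩
    change ‖e (θ x • x)‖ ^ 2 + θ x ^ 2 = 1
    rw [hsm, hθ2]
    have : 0 < 1 + ‖e x‖ ^ 2 := by positivity
    field_simp
    ring
  have hne : ∀ q ∈ closure S, ⁅(H : 𝔤), q.1⁆ ≠ 0 := by
    rintro ⟨y, t⟩ hq h0
    by_cases ht : t = 0
    · subst ht
      -- At infinity `y` is ad-nilpotent and in `𝔥`, hence zero, against the normalisation.
      have h1 := pow_natDegree_eq_zero_of_mem_closure hp.ne_zero (S := S) ?_ hq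
      · have hy : y = 0 := eq_zero_of_pow_adL_eq_zero (mem_cartan_of_lie_eq_zero hH h0) h1
        have := hone _ hq
        simp [hy] at this
      · rintro _ ⟨x, hx, rfl⟩
        exact ⟨x, adjointOrbit_subset_adVariety hH₀ hx.1, rfl⟩
    -- At finite distance the limit rescales to a point of the closed set `M'`, which would be
    -- critical over a regular value.
    · have hcont : ContinuousAt (fun q : 𝔤 × ℝ => q.2⁻¹ • q.1) (y, t) :=
        (continuousAt_snd.inv₀ ht).smul continuousAt_fst
      have hmem : t⁻¹ • y ∈ M' := by
        refine closure_minimal ?_ hM'c (mem_closure_image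
          (f := fun q : 𝔤 × ℝ => q.2⁻¹ • q.1) hcont hq)
        rintro _ ⟨_, ⟨x, hx, rfl⟩, rfl⟩
        change (θ x)⁻¹ • (θ x • x) ∈ M'
        rwa [inv_smul_smul₀ (hθ0 x).ne']
      refine hr _ hmem.2 ⟨t⁻¹ • y, (mem_criticalPoints_iff hp hH₀).2 ⟨hmem.1, ?_⟩, rfl⟩
      have h0' : ⁅(H : 𝔤), y⁆ = 0 := h0
      rw [hlie, h0', smul_zero]
  have hbdd : Bornology.IsBounded (closure S) := by
    have hb := e.symm.lipschitz.isBounded_image (Metric.isBounded_closedBall (x := 0) (r := 1))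
    refine (hb.prod (Metric.isBounded_closedBall (x := (0 : ℝ)) (r := 1))).subset fun q hq => ?_
    have h1 := hone q hq
    refine ⟨⟨e q.1, ?_, e.symm_apply_apply _⟩, ?_⟩
    · rw [mem_closedBall_zero_iff]
      nlinarith [sq_nonneg q.2, norm_nonneg (e q.1)]
    · rw [mem_closedBall_zero_iff, Real.norm_eq_abs]
      exact abs_le_one_iff_mul_self_le_one.2 (by nlinarith [sq_nonneg ‖e q.1‖])
  have hcomp : IsCompact (closure S) := Metric.isCompact_of_isClosed_isBounded isClosed_closure hbdd
  have hval : ∀ x, (1 + ‖e x‖ ^ 2)⁻¹ * ‖e ⁅(H : 𝔤), x⁆‖ ^ 2 = ‖e ⁅(H : 𝔤), θ x • x⁆‖ ^ 2 :=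
    fun x => by rw [hlie, hsm, hθ2]
  rcases S.eq_empty_or_nonempty with hemp | hnon
  · refine ⟨1, one_pos, fun x hx hx' => ?_⟩
    have : x ∈ M' := ⟨hx, hx'⟩
    rw [image_eq_empty.1 hemp] at this
    exact this.elim
  · have hc : Continuous fun q : 𝔤 × ℝ => ‖e ⁅(H : 𝔤), q.1⁆‖ ^ 2 := by
      simp only [hadL]
      exact ((e.continuous.comp ((adL (H : 𝔤)).continuous.comp continuous_fst)).norm.pow 2)
    obtain ⟨q, hq, hmin⟩ := hcomp.exists_isMinOn hnon.closure hc.continuousOn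
    refine ⟨‖e ⁅(H : 𝔤), q.1⁆‖ ^ 2, ?_, fun x hx hx' => ?_⟩
    · have : e ⁅(H : 𝔤), q.1⁆ ≠ 0 := (map_ne_zero_iff _ e.injective).2 (hne q hq)
      positivity
    · rw [hval]
      have hxS : (θ x • x, θ x) ∈ S := ⟨x, ⟨hx, hx'⟩, rfl⟩
      have := isMinOn_iff.1 hmin _ (subset_closure hxS)
      exact this

/-- The family `exp (s ad Y(x)) x` preserves the orbit. The weight in `Y` decays fast enough for
uniform estimates, and slowly enough for the rate of change of the height to stay above `δ`. -/
theorem eventually_areDiffeomorphic_fibre_heightFunction {p : ℂ[X]} (hp : Squarefree p) {H₀ : 𝔤}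
    (hH₀ : H₀ ∈ adVariety p) {H : 𝔥} (hH : IsRegularElement H) {c₀ : ℂ} {r : ℝ} (hr0 : 0 < r)
    (hr : ∀ c, ‖c - c₀‖ ≤ r → IsRegularValue (adjointOrbit H₀) (heightFunction (H : 𝔤)) c) :
    ∀ᶠ c in 𝓝 c₀, AreDiffeomorphic (fibre (adjointOrbit H₀) (heightFunction (H : 𝔤)) c₀)
      (fibre (adjointOrbit H₀) (heightFunction (H : 𝔤)) c) := by
  obtain ⟨δ, hδ, hlow⟩ := exists_le_norm_lie_div hp hH₀ hH hr
  obtain ⟨σ, hσ⟩ := exists_killingForm_eq_inner (𝔤 := 𝔤)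
  set e := hermEquiv 𝔤 with he
  set Z : 𝔤 →L[ℝ] 𝔤 := σ ∘L (adL (H : 𝔤)).restrictScalars ℝ with hZ
  obtain ⟨C, hC0, hC1, hC2⟩ := exists_rescaled_bounds e Z
  set Y : 𝔤 → 𝔤 := fun x => (1 + ‖e x‖ ^ 2)⁻¹ • Z x with hY
  have hYs : ContDiff ℝ ω Y := by
    have h1 : ContDiff ℝ ω fun x => ‖e x‖ ^ 2 :=
      (contDiff_norm_sq ℂ).comp (e.contDiff.restrict_scalars ℝ)
    exact ((contDiff_const.add h1).inv fun x => by positivity).smul Z.contDiff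
  obtain ⟨L, hL0, hA⟩ : ∃ L : ℝ, 0 ≤ L ∧ ∀ v : 𝔤, ‖adL v‖ ≤ L * ‖v‖ :=
    ⟨_, norm_nonneg _, (adL : 𝔤 →L[ℂ] 𝔤 →L[ℂ] 𝔤).le_opNorm⟩
  have hA0 : ∀ x, ‖adL (Y x)‖ ≤ L * C := fun x =>
    (hA _).trans (mul_le_mul_of_nonneg_left (hC0 x) hL0)
  have hA1 : ∀ x, ‖adL (Y x)‖ * ‖x‖ ≤ L * C := fun x => by
    calc _ ≤ L * ‖Y x‖ * ‖x‖ := by gcongr; exact hA _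
      _ = L * (‖Y x‖ * ‖x‖) := by ring
      _ ≤ _ := mul_le_mul_of_nonneg_left (hC1 x) hL0
  have hA2 : ∀ x x', ‖adL (Y x) - adL (Y x')‖ * min ‖x‖ ‖x'‖ ≤ L * C * ‖x - x'‖ := fun x x' => by
    rw [← map_sub]
    calc _ ≤ L * ‖Y x - Y x'‖ * min ‖x‖ ‖x'‖ := by gcongr; exact hA _
      _ = L * (‖Y x - Y x'‖ * min ‖x‖ ‖x'‖) := by ring
      _ ≤ L * (C * ‖x - x'‖) := mul_le_mul_of_nonneg_left (hC2 x x') hL0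
      _ = _ := by ring
  have hadL : ∀ (s : ℂ) x, s • adL (Y x) = adL (s • Y x) := fun s x => (map_smul _ _ _).symm
  have hest := exists_norm_exp_smul_apply_sub_le (A := fun x => adL (Y x)) hA0 hA1 hA2
  have hlip := norm_apply_sub_apply_le (A := fun x => adL (Y x)) hA0 hA2
  rw [← coe_heightL]
  refine eventually_areDiffeomorphic_fibre (f := heightL (H : 𝔤))
    (P := fun q => NormedSpace.exp (q.1 • adL (Y q.2)) q.2) (W := fun x => adL (Y x) x)
    (C := L * C) (K := 2 * (L * C)) (δ := δ) (r := r) ?_ ?_ ?_ hδ hr0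
    hest (fun x => ?_) hlip fun x hx hxr => ?_
  · have h1 : ContDiff ℝ ω fun q : ℂ × 𝔤 => q.1 • adL (Y q.2) :=
      contDiff_fst.smul ((adL.restrictScalars ℝ).contDiff.comp (hYs.comp contDiff_snd))
    have h2 : ContDiff ℝ ω fun q : ℂ × 𝔤 => NormedSpace.exp (q.1 • adL (Y q.2)) :=
      (contDiff_exp_adL (𝕜 := ℝ)).comp h1
    have h3 : ContDiff ℝ ω fun q : ℂ × 𝔤 => ((ContinuousLinearMap.restrictScalarsL ℂ 𝔤 𝔤 ℝ ℝ)
        (NormedSpace.exp (q.1 • adL (Y q.2)))) q.2 :=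
      ((ContinuousLinearMap.restrictScalarsL ℂ 𝔤 𝔤 ℝ ℝ).contDiff.comp h2).clm_apply contDiff_snd
    exact h3
  · intro s x
    simp only [hadL]
    exact exp_adL_apply_mem_adjointOrbit_iff
  · intro x
    simp
  · exact ((adL (Y x)).le_opNorm x).trans (hA1 x)
  · refine (hlow x hx hxr).trans_eq ?_
    set w := ⁅(H : 𝔤), x⁆ with hw
    set t : ℝ := (1 + ‖e x‖ ^ 2)⁻¹ with ht
    have ht0 : 0 ≤ t := by positivity
    -- Invariance moves the bracket onto `H`, and `σ` converts the Killing form into the Hermitian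
    -- product.
    have h1 : killingForm ℂ 𝔤 (H : 𝔤) ⁅Y x, x⁆ = -((t : ℂ) * inner ℂ (e w) (e w)) := by
      have hYx : Y x = (t : ℂ) • σ w := rfl
      rw [← lie_skew, map_neg, ← killingForm_lie, killingForm_symm, hYx, map_smul,
        LinearMap.smul_apply, hσ, smul_eq_mul]
    change _ = ‖killingForm ℂ 𝔤 (H : 𝔤) ⁅Y x, x⁆‖
    rw [h1, norm_neg, norm_mul, Complex.norm_real, Real.norm_of_nonneg ht0,
      inner_self_eq_norm_sq_to_K, norm_pow]
    simp

/-- Regular fibres of a height function are diffeomorphic. -/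
theorem areDiffeomorphic_fibre_heightFunction {p : ℂ[X]} (hp : Squarefree p) {H₀ : 𝔤}
    (hH₀ : H₀ ∈ adVariety p) {H : 𝔥} (hH : IsRegularElement H) {c₁ c₂ : ℂ}
    (h₁ : IsRegularValue (adjointOrbit H₀) (heightFunction (H : 𝔤)) c₁)
    (h₂ : IsRegularValue (adjointOrbit H₀) (heightFunction (H : 𝔤)) c₂) :
    AreDiffeomorphic (fibre (adjointOrbit H₀) (heightFunction (H : 𝔤)) c₁)
      (fibre (adjointOrbit H₀) (heightFunction (H : 𝔤)) c₂) := by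
  set V : Set ℂ := heightFunction (H : 𝔤) '' criticalPoints (adjointOrbit H₀)
    (heightFunction (H : 𝔤)) with hV
  have hVf : V.Finite := (finite_criticalPoints hp hH₀ hH).image _
  -- Removing finitely many points does not disconnect the plane, and being diffeomorphic is an
  -- equivalence relation that holds locally there.
  have hconn : IsPreconnected Vᶜ :=
    (hVf.countable.isConnected_compl_of_one_lt_rank (by simp)).isPreconnected
  refine hconn.induction₂ (fun c c' => AreDiffeomorphic
    (fibre (adjointOrbit H₀) (heightFunction (H : 𝔤)) c)
    (fibre (adjointOrbit H₀) (heightFunction (H : 𝔤)) c')) (fun c hc => ?_)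
    (fun _ _ _ _ _ _ => .trans) (fun _ _ _ _ => .symm) h₁ h₂
  obtain ⟨r, hr, hball⟩ := Metric.nhds_basis_closedBall.mem_iff.1
    (hVf.isClosed.isOpen_compl.mem_nhds hc)
  exact nhdsWithin_le_nhds (eventually_areDiffeomorphic_fibre_heightFunction hp hH₀ hH hr
    fun c' hc' => hball (by rwa [mem_closedBall_iff_norm]))

end RegularFibres
end

/-! ### The main theorem -/

theorem mainTheorem1 {𝔤 : Type*} [NormedLieRing 𝔤] [NormedLieAlgebra ℂ 𝔤] [FiniteDimensional ℂ 𝔤]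
    [LieAlgebra.IsSemisimple ℂ 𝔤] (𝔥 : LieSubalgebra ℂ 𝔤) [𝔥.IsCartanSubalgebra]
    (H₀ H : 𝔥) (hHreal : H ∈ realCartan 𝔥) (hHreg : IsRegularElement H) :
    ∃ n : ℕ,
      IsSubmanifold ℂ (2 * n) (adjointOrbit (H₀ : 𝔤)) ∧
      (criticalPoints (adjointOrbit (H₀ : 𝔤)) (heightFunction (H : 𝔤))).Finite ∧
      (∀ x ∈ criticalPoints (adjointOrbit (H₀ : 𝔤)) (heightFunction (H : 𝔤)),
        HessianNondegenerate (adjointOrbit (H₀ : 𝔤)) (heightFunction (H : 𝔤)) x) ∧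
      (∀ c₁ c₂ : ℂ, IsRegularValue (adjointOrbit (H₀ : 𝔤)) (heightFunction (H : 𝔤)) c₁ →
        IsRegularValue (adjointOrbit (H₀ : 𝔤)) (heightFunction (H : 𝔤)) c₂ →
        AreDiffeomorphic (fibre (adjointOrbit (H₀ : 𝔤)) (heightFunction (H : 𝔤)) c₁)
          (fibre (adjointOrbit (H₀ : 𝔤)) (heightFunction (H : 𝔤)) c₂)) ∧
      ∃ Ω : 𝔤 → 𝔤 [⋀^Fin 2]→L[ℝ] ℝ,
        IsSymplecticForm (adjointOrbit (H₀ : 𝔤)) Ω ∧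
        (∀ c : ℂ, IsRegularValue (adjointOrbit (H₀ : 𝔤)) (heightFunction (H : 𝔤)) c →
          IsSymplecticSubmanifold (adjointOrbit (H₀ : 𝔤)) Ω
            (fibre (adjointOrbit (H₀ : 𝔤)) (heightFunction (H : 𝔤)) c)) ∧
        (∀ c : ℂ, IsCriticalValue (adjointOrbit (H₀ : 𝔤)) (heightFunction (H : 𝔤)) c →
          ∃ S : Set (AffineSubspace ℂ 𝔤),
            fibre (adjointOrbit (H₀ : 𝔤)) (heightFunction (H : 𝔤)) c = ⋃ A ∈ S, (A : Set 𝔤) ∧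
            S.PairwiseDisjoint (fun A => (A : Set 𝔤)) ∧
            ∀ A ∈ S, (A : Set 𝔤).Nonempty ∧
              (Module.finrank ℂ A.direction = n ∨ Module.finrank ℂ A.direction + 1 = n) ∧
              IsSymplecticSubmanifold (adjointOrbit (H₀ : 𝔤)) Ω (A : Set 𝔤)) := by
  obtain ⟨p, hp, hH₀⟩ := exists_squarefree_mem_adVariety H₀.2
  obtain ⟨l, δ, hδ, hl⟩ := exists_linear_functional hp.ne_zero
  have hM : ∀ x ∈ adjointOrbit (H₀ : 𝔤), ∃ V : Submodule ℂ 𝔤,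
      tangentSpaceAt (adjointOrbit (H₀ : 𝔤)) x = V.restrictScalars ℝ :=
    fun x hx => ⟨_, tangentSpaceAt_adjointOrbit hp hH₀ hx⟩
  -- The half-dimension `n` is realised as the dimension of the affine leaves.
  refine ⟨Module.finrank ℂ (eigenFiltration (H₀ : 𝔤) l δ), ?_, finite_criticalPoints hp hH₀ hHreg,
    fun x hx => ?_, fun c₁ c₂ => areDiffeomorphic_fibre_heightFunction hp hH₀ hHreg,
    fun _ => kahlerForm 𝔤, isSymplecticForm_kahlerForm hM,
    fun c hc => isSymplecticSubmanifold_fibre hp hH₀ hc, fun c _ => ?_⟩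
  · rw [← two_mul_finrank_eigenFiltration hp hH₀ hδ hl]
    exact isSubmanifold_adjointOrbit hp hH₀
  · obtain ⟨hxM, hHx⟩ := (mem_criticalPoints_iff hp hH₀).1 hx
    exact hessianNondegenerate_of_lie_eq_zero hp hH₀ hxM hHreg hHx
  · obtain ⟨S, hS, hdisj, hA⟩ :=
      exists_affine_decomposition_fibre (l := l) hp.ne_zero hH₀ hδ (H : 𝔤) c
    refine ⟨S, hS, hdisj, fun A hAS => ?_⟩
    obtain ⟨hne, hdim, hsub⟩ := hA A hAS
    exact ⟨hne, hdim, AffineSubspace.isSymplecticSubmanifold_kahlerForm A hsub⟩
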